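/- **Theorem 2.1.** For $K\in\mathbb R$ let $\mathrm{sn}_K$ be the solution of $\mathrm{sn}_K''+K\,\mathrm{sn}_K=0$, $\mathrm{sn}_K(0)=0$, $\mathrm{sn}_K'(0)=1$, and put $\mathrm{cs}_K=\mathrm{sn}_K'$, $\mathrm{tn}_K=K\,\mathrm{sn}_K/\mathrm{cs}_K$. For an integer $n\ge 2$ and $D>0$ (with $D<\pi/\sqrt K$ if $K>0$) let $\bar\lambda_1(n,D,K)<\bar\lambda_2(n,D,K)$ be the first two (simple, attained) eigenvalues of the Dirichlet problem $$\phi''-(n-1)\,\mathrm{tn}_K(s)\,\phi'+\lambda\phi=0\ \text{ on } \left[-\tfrac D2,\tfrac D2\right],\qquad \phi\left(\pm\tfrac D2\right)=0 .$$ 1. Let $K>0$. On $D\in(0,\pi/\sqrt K)$ the function $D\mapsto D^2\left(\bar\lambda_2-\bar\lambda_1\right)(n,D,K)$ is strictly increasing for every $n>3$, and strictly decreasing for $n=2$. 2. For every $n\ge 3$ and $D\in(0,\pi)$, $$\bar\lambda_2(n,D,1)-\bar\lambda_1(n,D,1)\ \ge\ \frac{3\pi^2}{D^2}.$$ 3.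 Let $K<0$ and $m_K(s)=K\,\mathrm{cs}_K(s)^{-2}\left(1+s\,\mathrm{tn}_K(s)\right)$. Then $m_K'$ has exactly one zero on $(0,\infty)$; call it $a(K)$. On $D\in(0,a(K)]$ the function $D\mapsto D^2\left(\bar\lambda_2-\bar\lambda_1\right)(n,D,K)$ is strictly increasing for every $n>3$ and strictly decreasing for $n=2$, and for every $n\ge3$ and $D\in(0,a(K)]$, $$\bar\lambda_2(n,D,K)-\bar\lambda_1(n,D,K)\ \ge\ \frac{3\pi^2}{D^2}.$$ -/

import Mathlib

noncomputable section

namespace ModelGap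

/-- `sn_K`, the solution of `sn'' + K sn = 0`, `sn 0 = 0`, `sn' 0 = 1`. -/
def sn (K s : ℝ) : ℝ :=
  if 0 < K then Real.sin (√K * s) / √K
  else if K < 0 then Real.sinh (√(-K) * s) / √(-K)
  else s

/-- `cs_K`, the derivative of `sn_K`. -/
def cs (K s : ℝ) : ℝ :=
  if 0 < K then Real.cos (√K * s)
  else if K < 0 then Real.cosh (√(-K) * s)
  else 1

/-- `tn_K = K sn_K / cs_K = - cs_K' / cs_K`. -/
def tn (K s : ℝ) : ℝ := K * sn K s / cs K s

/-- `lam` is a Dirichlet eigenvalue of the one-dimensional model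
`φ'' - (n-1) tn_K φ' + lam φ = 0` on `[-D/2, D/2]`: there is a solution `φ`, twice differentiable up
to the boundary with derivatives `dφ`, `ddφ`, vanishing at `± D/2` and not identically zero.
(The equation makes `ddφ` continuous where `cs_K` does not vanish.) -/
def IsEigenvalue (n : ℕ) (D K lam : ℝ) : Prop :=
  ∃ φ dφ ddφ : ℝ → ℝ,
    (∀ s ∈ Set.Icc (-(D / 2)) (D / 2),
      HasDerivWithinAt φ (dφ s) (Set.Icc (-(D / 2)) (D / 2)) s ∧
      HasDerivWithinAt dφ (ddφ s) (Set.Icc (-(D / 2)) (D / 2)) s ∧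
      ddφ s - ((n : ℝ) - 1) * tn K s * dφ s + lam * φ s = 0) ∧
    φ (-(D / 2)) = 0 ∧ φ (D / 2) = 0 ∧
    ∃ s ∈ Set.Icc (-(D / 2)) (D / 2), φ s ≠ 0

/-- The set of all Dirichlet eigenvalues of the model. -/
def eigenvalues (n : ℕ) (D K : ℝ) : Set ℝ := {lam | IsEigenvalue n D K lam}

/-- The first Dirichlet eigenvalue of the model. -/
def lambda1 (n : ℕ) (D K : ℝ) : ℝ := sInf (eigenvalues n D K)

/-- The second Dirichlet eigenvalue of the model: the smallest one above the first. (The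
eigenvalues are simple, two solutions vanishing at the same endpoint being proportional, so
that counting them with multiplicity makes no difference.) -/
def lambda2 (n : ℕ) (D K : ℝ) : ℝ := sInf (eigenvalues n D K ∩ Set.Ioi (lambda1 n D K))

/-- The gap of the model. -/
def gap (n : ℕ) (D K : ℝ) : ℝ := lambda2 n D K - lambda1 n D K

/-- `m_K(s) = K cs_K(s)⁻² (1 + s tn_K(s))`, half the derivative of `tn_K(s) + s K cs_K(s)⁻²`. -/
def m (K s : ℝ) : ℝ := K * (cs K s ^ 2)⁻¹ * (1 + s * tn K s)

end ModelGap

end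

namespace ModelGap

open Set Filter Topology

/-! Put `l = D / 2`. Substituting `u(x) = cs_K(l x)^((n-1)/2) φ(l x)` removes the first-order term
of the model and moves it to `[-1, 1]`, giving `-u'' + Q u = μ u` with the even potential `Q(x) =
(n-1)(n-3)/4 · l² f(l x)`, where `f = K / cs_K² = tn_K'`. The spectral parameter changes by an
affine map of slope `l²`, so `D² · gap` is four times the gap of `Q` (`mem_eigenvalues_iff`,
`exists_isGapData_potential`).

The core is a comparison theorem for even potentials on `[-1, 1]`: if `R - Q` increases on `[0, 1]`,
the gap of `R` is at least that of `Q`, strictly if the increase is strict (`gap_le_gap`,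
`gap_lt_gap`). Let `u, v` and `p, w` be the first two eigenfunctions of `Q` and of `R`, and put `g =
p / u`, `h = w / v`. The quantity `F = u² (h g' - g h')` tends to zero at both ends of `(0, 1)`, and
its derivative is a positive multiple of the difference of the gaps plus a term that is nonpositive
because `h' ≤ 0` and `v / u` increases. A gap of `R` not exceeding that of `Q` therefore forces `F`
to vanish, the gaps to agree and `h` to be constant, so that `R - Q` is constant on `(0, 1)`.

For two lengths, the difference of the profiles `l² f(l x)` strictly increases in `x` as soon as `s³
f'(s)` strictly increases in `s`. Since `(s³ f')' = 2 s² m_K'`, this is where `m_K` enters. The sign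
of `(n-1)(n-3)` then decides the direction of monotonicity in `D`. For `n ≥ 3` the potential itself
is nondecreasing on `[0, 1]`, and comparison with the zero potential gives the bound `3π² / D²`.

Existence and parity of the two eigenvalues come from Prüfer angles started at the center: at `π/2`
for even solutions, at `0` for odd ones (`exists_isGapData`). -/

/-! ### Integrating factors and comparison of angles -/

lemma sin_sq_sub_sin_sq (x y : ℝ) :
    Real.sin y ^ 2 - Real.sin x ^ 2 = Real.sinc (y - x) * Real.sin (y + x) * (y - x) := by
  have h : Real.sinc (y - x) * (y - x) = Real.sin (y - x) := by
    by_cases h0 : y - x = 0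
    · simp [h0]
    · rw [Real.sinc_of_ne_zero h0]; field_simp
  have h2 : Real.sin y ^ 2 - Real.sin x ^ 2 = Real.sin (y - x) * Real.sin (y + x) := by
    rw [Real.sin_sub, Real.sin_add]
    have hx := Real.sin_sq_add_cos_sq x
    have hy := Real.sin_sq_add_cos_sq y
    linear_combination Real.sin y ^ 2 * hx.symm - Real.sin x ^ 2 * hy.symm
  rw [h2, ← h]; ring

/-- An antiderivative of a continuous function on a compact interval, normalized at an arbitrary
point of the interval, with the obvious bound. -/
lemma exists_antideriv {a b c C : ℝ} (hc : c ∈ Icc a b) {f : ℝ → ℝ}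
    (hf : ContinuousOn f (Icc a b)) (hC : ∀ t ∈ Icc a b, |f t| ≤ C) :
    ∃ F : ℝ → ℝ, F c = 0 ∧ (∀ t ∈ Icc a b, HasDerivWithinAt F (f t) (Icc a b) t) ∧
      ∀ t ∈ Icc a b, |F t| ≤ C * (b - a) := by
  have hab : a ≤ b := hc.1.trans hc.2
  have hg : Continuous (IccExtend hab ((Icc a b).domRestrict f)) :=
    (continuousOn_iff_continuous_domRestrict.1 hf).Icc_extend'
  set g := IccExtend hab ((Icc a b).domRestrict f) with hgdef
  have hgf : ∀ t ∈ Icc a b, g t = f t := fun t ht => by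
    rw [hgdef, IccExtend_of_mem _ _ ht]; rfl
  refine ⟨fun t => ∫ s in c..t, g s, by simp, fun t ht => ?_, fun t ht => ?_⟩
  · rw [← hgf t ht]
    exact (intervalIntegral.integral_hasDerivAt_right (hg.intervalIntegrable _ _)
      hg.stronglyMeasurable.stronglyMeasurableAtFilter hg.continuousAt).hasDerivWithinAt
  · have hC0 : 0 ≤ C := (abs_nonneg _).trans (hC c hc)
    have h1 : ‖∫ s in c..t, g s‖ ≤ C * |t - c| := by
      refine intervalIntegral.norm_integral_le_of_norm_le_const fun s hs => ?_
      have hs' : s ∈ Icc a b := by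
        have := uIoc_subset_uIcc hs
        exact (uIcc_subset_Icc hc ht) this
      rw [hgf s hs']; exact hC s hs'
    refine h1.trans (mul_le_mul_of_nonneg_left ?_ hC0)
    rw [abs_le]; constructor <;> linarith [ht.1, ht.2, hc.1, hc.2]

/-- Integrating factor for the difference of two Prüfer angles. -/
lemma exists_integrating_factor {a b C : ℝ} (hab : a ≤ b) {q θ₁ θ₂ d₁ d₂ : ℝ → ℝ}
    (hq : ContinuousOn q (Icc a b)) (hC : ∀ t ∈ Icc a b, |q t| ≤ C)
    (h₁ : ∀ t ∈ Icc a b, HasDerivWithinAt θ₁ (d₁ t) (Icc a b) t)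
    (h₂ : ∀ t ∈ Icc a b, HasDerivWithinAt θ₂ (d₂ t) (Icc a b) t) :
    ∃ A : ℝ → ℝ, (∀ t ∈ Icc a b, |A t| ≤ C * (b - a)) ∧
      ∀ t ∈ Icc a b, HasDerivWithinAt (fun t => Real.exp (A t) * (θ₂ t - θ₁ t))
        (Real.exp (A t) * (d₂ t - d₁ t -
          q t * (Real.sin (θ₂ t) ^ 2 - Real.sin (θ₁ t) ^ 2))) (Icc a b) t := by
  have c₁ : ContinuousOn θ₁ (Icc a b) := fun t ht => (h₁ t ht).continuousWithinAt
  have c₂ : ContinuousOn θ₂ (Icc a b) := fun t ht => (h₂ t ht).continuousWithinAt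
  -- Writing `sin² θ₂ - sin² θ₁` as a multiple of `θ₂ - θ₁` makes the equation for the difference
  -- linear. The use of `sinc` keeps the coefficient continuous where the angles meet, and bounded
  -- by `C` whatever the angles are.
  set f : ℝ → ℝ := fun t => -(q t * (Real.sinc (θ₂ t - θ₁ t) * Real.sin (θ₂ t + θ₁ t))) with hf
  have cf : ContinuousOn f (Icc a b) :=
    (hq.mul ((Real.continuous_sinc.comp_continuousOn (c₂.sub c₁)).mul
      (Real.continuous_sin.comp_continuousOn (c₂.add c₁)))).neg
  have bf : ∀ t ∈ Icc a b, |f t| ≤ C := by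
    intro t ht
    rw [hf, abs_neg, abs_mul, abs_mul]
    have h1 := Real.abs_sinc_le_one (θ₂ t - θ₁ t)
    have h2 := Real.abs_sin_le_one (θ₂ t + θ₁ t)
    calc |q t| * (|Real.sinc (θ₂ t - θ₁ t)| * |Real.sin (θ₂ t + θ₁ t)|) ≤ |q t| * (1 * 1) := by
          gcongr
      _ ≤ C := by simpa using hC t ht
  obtain ⟨A, -, hA, hAb⟩ := exists_antideriv (left_mem_Icc.2 hab) cf bf
  refine ⟨A, hAb, fun t ht => ?_⟩
  refine ((hA t ht).exp.mul ((h₂ t ht).sub (h₁ t ht))).congr_deriv ?_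
  rw [sin_sq_sub_sin_sq, hf, Pi.sub_apply]
  ring

lemma monotoneOn_of_deriv_Icc {a b : ℝ} {f f' : ℝ → ℝ}
    (h : ∀ t ∈ Icc a b, HasDerivWithinAt f (f' t) (Icc a b) t)
    (h0 : ∀ t ∈ Icc a b, 0 ≤ f' t) : MonotoneOn f (Icc a b) :=
  monotoneOn_of_hasDerivWithinAt_nonneg (convex_Icc a b)
    (fun t ht => (h t ht).continuousWithinAt)
    (fun t ht => (h t (interior_subset ht)).mono interior_subset)
    (fun t ht => h0 t (interior_subset ht))

section Comparison

variable {a b : ℝ} {q θ₁ θ₂ d₁ d₂ : ℝ → ℝ}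

lemma exists_integrating_factor_mono (hab : a ≤ b)
    (hq : ContinuousOn q (Icc a b))
    (h₁ : ∀ t ∈ Icc a b, HasDerivWithinAt θ₁ (d₁ t) (Icc a b) t)
    (h₂ : ∀ t ∈ Icc a b, HasDerivWithinAt θ₂ (d₂ t) (Icc a b) t)
    (hd : ∀ t ∈ Icc a b,
      q t * (Real.sin (θ₂ t) ^ 2 - Real.sin (θ₁ t) ^ 2) ≤ d₂ t - d₁ t) :
    ∃ A : ℝ → ℝ, MonotoneOn (fun t => Real.exp (A t) * (θ₂ t - θ₁ t)) (Icc a b) ∧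
      ∀ t ∈ Icc a b, HasDerivWithinAt (fun t => Real.exp (A t) * (θ₂ t - θ₁ t))
        (Real.exp (A t) * (d₂ t - d₁ t -
          q t * (Real.sin (θ₂ t) ^ 2 - Real.sin (θ₁ t) ^ 2))) (Icc a b) t := by
  obtain ⟨C, hC⟩ := isCompact_Icc.exists_bound_of_continuousOn hq
  obtain ⟨A, -, hA⟩ := exists_integrating_factor hab hq hC h₁ h₂
  refine ⟨A, monotoneOn_of_deriv_Icc hA fun t ht => ?_, hA⟩
  exact mul_nonneg (Real.exp_pos _).le (by linarith [hd t ht])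

/-- Comparison of Prüfer angles. -/
lemma prufer_le (hab : a ≤ b) (hq : ContinuousOn q (Icc a b))
    (h₁ : ∀ t ∈ Icc a b, HasDerivWithinAt θ₁ (d₁ t) (Icc a b) t)
    (h₂ : ∀ t ∈ Icc a b, HasDerivWithinAt θ₂ (d₂ t) (Icc a b) t)
    (hd : ∀ t ∈ Icc a b,
      q t * (Real.sin (θ₂ t) ^ 2 - Real.sin (θ₁ t) ^ 2) ≤ d₂ t - d₁ t)
    (h0 : θ₁ a ≤ θ₂ a) : θ₁ b ≤ θ₂ b := by
  obtain ⟨A, hA, -⟩ := exists_integrating_factor_mono hab hq h₁ h₂ hd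
  have h := hA (left_mem_Icc.2 hab) (right_mem_Icc.2 hab) hab
  have h1 : 0 ≤ Real.exp (A a) * (θ₂ a - θ₁ a) :=
    mul_nonneg (Real.exp_pos _).le (by linarith)
  have := (mul_nonneg_iff_of_pos_left (Real.exp_pos (A b))).1 (h1.trans h)
  linarith

lemma prufer_lt_of_lt (hab : a ≤ b) (hq : ContinuousOn q (Icc a b))
    (h₁ : ∀ t ∈ Icc a b, HasDerivWithinAt θ₁ (d₁ t) (Icc a b) t)
    (h₂ : ∀ t ∈ Icc a b, HasDerivWithinAt θ₂ (d₂ t) (Icc a b) t)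
    (hd : ∀ t ∈ Icc a b,
      q t * (Real.sin (θ₂ t) ^ 2 - Real.sin (θ₁ t) ^ 2) ≤ d₂ t - d₁ t)
    (h0 : θ₁ a < θ₂ a) : θ₁ b < θ₂ b := by
  obtain ⟨A, hA, -⟩ := exists_integrating_factor_mono hab hq h₁ h₂ hd
  have h := hA (left_mem_Icc.2 hab) (right_mem_Icc.2 hab) hab
  have h1 : 0 < Real.exp (A a) * (θ₂ a - θ₁ a) :=
    mul_pos (Real.exp_pos _) (by linarith)
  have := (mul_pos_iff_of_pos_left (Real.exp_pos (A b))).1 (h1.trans_le h)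
  linarith

/-- The weighted difference is nondecreasing and starts nonnegative. If it ended at zero it would
vanish identically, against its positive derivative at the point of strictness. -/
lemma prufer_lt_of_deriv_lt (hq : ContinuousOn q (Icc a b))
    (h₁ : ∀ t ∈ Icc a b, HasDerivWithinAt θ₁ (d₁ t) (Icc a b) t)
    (h₂ : ∀ t ∈ Icc a b, HasDerivWithinAt θ₂ (d₂ t) (Icc a b) t)
    (hd : ∀ t ∈ Icc a b,
      q t * (Real.sin (θ₂ t) ^ 2 - Real.sin (θ₁ t) ^ 2) ≤ d₂ t - d₁ t)
    (hs : ∃ t ∈ Ioo a b, q t * (Real.sin (θ₂ t) ^ 2 - Real.sin (θ₁ t) ^ 2) < d₂ t - d₁ t)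
    (h0 : θ₁ a ≤ θ₂ a) : θ₁ b < θ₂ b := by
  obtain ⟨s, hs, hlt⟩ := hs
  have hab : a ≤ b := hs.1.le.trans hs.2.le
  obtain ⟨A, hA, hA'⟩ := exists_integrating_factor_mono hab hq h₁ h₂ hd
  refine lt_of_le_of_ne (prufer_le hab hq h₁ h₂ hd h0) fun hb => ?_
  set E := fun t => Real.exp (A t) * (θ₂ t - θ₁ t) with hE
  have hEa : 0 ≤ E a := mul_nonneg (Real.exp_pos _).le (by linarith)
  have hEb : E b = 0 := by simp [hE, hb]
  have hE0 : ∀ t ∈ Icc a b, E t = 0 := fun t ht =>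
    le_antisymm (hEb ▸ hA ht (right_mem_Icc.2 hab) ht.2)
      (hEa.trans (hA (left_mem_Icc.2 hab) ht ht.1))
  have hsI : Icc a b ∈ 𝓝 s := Icc_mem_nhds hs.1 hs.2
  have h1 := (hA' s (Ioo_subset_Icc_self hs)).hasDerivAt hsI
  have h2 : HasDerivAt E 0 s := by
    refine (hasDerivAt_const s (0 : ℝ)).congr_of_eventuallyEq ?_
    filter_upwards [hsI] with t ht using hE0 t ht
  have h3 := h1.unique h2
  have : 0 < Real.exp (A s) * (d₂ s - d₁ s -
      q s * (Real.sin (θ₂ s) ^ 2 - Real.sin (θ₁ s) ^ 2)) :=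
    mul_pos (Real.exp_pos _) (by linarith)
  linarith

end Comparison

/-! ### The Prüfer equation -/

/-- `θ` solves the Prüfer equation `θ' = 1 + q sin² θ` on `[-1, 1]`. -/
def IsPrufer (q θ : ℝ → ℝ) : Prop :=
  ∀ t ∈ Icc (-1 : ℝ) 1,
    HasDerivWithinAt θ (1 + q t * Real.sin (θ t) ^ 2) (Icc (-1 : ℝ) 1) t

lemma exists_isPrufer {q : ℝ → ℝ} (hq : ContinuousOn q (Icc (-1 : ℝ) 1)) (θ₀ : ℝ) :
    ∃ θ : ℝ → ℝ, θ 0 = θ₀ ∧ IsPrufer q θ := by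
  obtain ⟨C, hC⟩ := isCompact_Icc.exists_bound_of_continuousOn hq
  have hC0 : 0 ≤ C := (norm_nonneg _).trans (hC 0 (by norm_num))
  let c : NNReal := ⟨C, hC0⟩
  -- The field is bounded by `1 + c` everywhere and times are at distance at most `1` from `0`, so a
  -- ball of radius `1 + c` contains the solution on the whole interval.
  have hPL : IsPicardLindelof (fun t x => 1 + q t * Real.sin x ^ 2)
      (⟨0, by norm_num⟩ : Icc (-1 : ℝ) 1) θ₀ (1 + c) 0 (1 + c) (2 * c) := by
    constructor
    · intro t ht
      refine LipschitzWith.lipschitzOnWith ?_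
      refine LipschitzWith.of_dist_le_mul fun x y => ?_
      have h := sin_sq_sub_sin_sq y x
      rw [Real.dist_eq, Real.dist_eq]
      have h2 : |Real.sin x + Real.sin y| ≤ 2 := by
        rw [abs_le]
        constructor <;> linarith [Real.neg_one_le_sin x, Real.neg_one_le_sin y, Real.sin_le_one x,
          Real.sin_le_one y]
      have h3 : |Real.sin x - Real.sin y| ≤ |x - y| := by
        have := Real.lipschitzWith_sin.dist_le_mul x y
        simpa [Real.dist_eq] using this
      have h4 : (1 + q t * Real.sin x ^ 2) - (1 + q t * Real.sin y ^ 2) =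
          q t * ((Real.sin x + Real.sin y) * (Real.sin x - Real.sin y)) := by ring
      rw [h4, abs_mul, abs_mul]
      calc |q t| * (|Real.sin x + Real.sin y| * |Real.sin x - Real.sin y|)
          ≤ C * (2 * |x - y|) := by
            gcongr
            exact hC t ht
        _ = ((2 * c : NNReal) : ℝ) * |x - y| := by
            push_cast
            change C * (2 * |x - y|) = 2 * C * |x - y|
            ring
    · intro x _
      exact continuousOn_const.add (hq.mul continuousOn_const)
    · intro t ht x _
      have h1 : |q t * Real.sin x ^ 2| ≤ C := by
        rw [abs_mul, abs_of_nonneg (sq_nonneg (Real.sin x))]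
        calc |q t| * Real.sin x ^ 2 ≤ C * 1 := by
              gcongr
              · exact hC t ht
              · exact Real.sin_sq_le_one x
          _ = C := mul_one C
      calc ‖1 + q t * Real.sin x ^ 2‖ ≤ ‖(1 : ℝ)‖ + ‖q t * Real.sin x ^ 2‖ := norm_add_le _ _
        _ ≤ 1 + C := by rw [norm_one]; gcongr; exact h1
    · simp
  obtain ⟨θ, h0, hθ⟩ := hPL.exists_eq_forall_mem_Icc_hasDerivWithinAt₀
  exact ⟨θ, h0, hθ⟩

namespace IsPrufer

variable {q q₁ q₂ θ θ₁ θ₂ : ℝ → ℝ} {a b : ℝ}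

lemma hasDerivWithinAt_sub (h : IsPrufer q θ) (ha : -1 ≤ a) (hb : b ≤ 1) :
    ∀ t ∈ Icc a b, HasDerivWithinAt θ (1 + q t * Real.sin (θ t) ^ 2) (Icc a b) t :=
  fun t ht => (h t (Icc_subset_Icc ha hb ht)).mono (Icc_subset_Icc ha hb)

lemma continuousOn (h : IsPrufer q θ) : ContinuousOn θ (Icc (-1 : ℝ) 1) :=
  fun t ht => (h t ht).continuousWithinAt

/-- Multiples of `π` are crossed upwards. -/
lemma int_mul_pi_lt (h : IsPrufer q θ) (hq : ContinuousOn q (Icc (-1 : ℝ) 1)) (ha : -1 ≤ a)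
    (hab : a < b) (hb : b ≤ 1) {k : ℤ} (hk : k * Real.pi ≤ θ a) : k * Real.pi < θ b := by
  have hd : ∀ t, q t * (Real.sin (θ t) ^ 2 - Real.sin (k * Real.pi) ^ 2) <
      (1 + q t * Real.sin (θ t) ^ 2) - 0 := by
    intro t; rw [Real.sin_int_mul_pi]; linarith
  exact prufer_lt_of_deriv_lt (θ₁ := fun _ => k * Real.pi) (d₁ := fun _ => 0)
    (hq.mono (Icc_subset_Icc ha hb)) (fun t _ => hasDerivWithinAt_const _ _ _)
    (h.hasDerivWithinAt_sub ha hb) (fun t _ => (hd t).le)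
    ⟨(a + b) / 2, ⟨by linarith, by linarith⟩, hd _⟩ hk

/-- For `q ≤ -1` the field is nonpositive at `π/2`, so the constant `π/2` is a barrier from above.
-/
lemma le_pi_div_two (h : IsPrufer q θ) (hq : ContinuousOn q (Icc (-1 : ℝ) 1))
    (hq1 : ∀ t ∈ Icc (-1 : ℝ) 1, q t ≤ -1) (h0 : θ 0 ≤ Real.pi / 2) : θ 1 ≤ Real.pi / 2 := by
  refine prufer_le (θ₂ := fun _ => Real.pi / 2) (d₂ := fun _ => 0) zero_le_one
    (hq.mono (Icc_subset_Icc (by norm_num) le_rfl))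
    (h.hasDerivWithinAt_sub (by norm_num) le_rfl) (fun t _ => hasDerivWithinAt_const _ _ _)
    (fun t ht => ?_) h0
  have := hq1 t ⟨by linarith [ht.1], ht.2⟩
  rw [Real.sin_pi_div_two]
  linarith

lemma lt_of_lt (h₁ : IsPrufer q θ₁) (h₂ : IsPrufer q θ₂) (hq : ContinuousOn q (Icc (-1 : ℝ) 1))
    (h0 : θ₁ 0 < θ₂ 0) : θ₁ 1 < θ₂ 1 :=
  prufer_lt_of_lt zero_le_one (hq.mono (Icc_subset_Icc (by norm_num) le_rfl))
    (h₁.hasDerivWithinAt_sub (by norm_num) le_rfl) (h₂.hasDerivWithinAt_sub (by norm_num) le_rfl)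
    (fun t _ => le_of_eq (by ring)) h0

lemma le_of_le (h₁ : IsPrufer q₁ θ₁) (h₂ : IsPrufer q₂ θ₂)
    (hq : ContinuousOn q₁ (Icc (-1 : ℝ) 1)) (hle : ∀ t ∈ Icc (-1 : ℝ) 1, q₁ t ≤ q₂ t)
    (h0 : θ₁ 0 ≤ θ₂ 0) : θ₁ 1 ≤ θ₂ 1 := by
  refine prufer_le zero_le_one (hq.mono (Icc_subset_Icc (by norm_num) le_rfl))
    (h₁.hasDerivWithinAt_sub (by norm_num) le_rfl) (h₂.hasDerivWithinAt_sub (by norm_num) le_rfl)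
    (fun t ht => ?_) h0
  have := mul_nonneg (sub_nonneg.2 (hle t ⟨by linarith [ht.1], ht.2⟩)) (sq_nonneg (Real.sin (θ₂ t)))
  linarith

/-- Where `sin θ` vanishes the angle moves with speed one, so it cannot stay there. This supplies
the point at which a strict inequality between coefficients is felt. -/
lemma exists_sin_ne_zero (h : IsPrufer q θ) : ∃ t ∈ Ioo (0 : ℝ) 1, Real.sin (θ t) ≠ 0 := by
  by_contra! hz
  have hm : (1 / 2 : ℝ) ∈ Ioo (0 : ℝ) 1 := by norm_num
  have hd : HasDerivAt θ _ (1 / 2) :=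
    (h (1 / 2) (by norm_num)).hasDerivAt (Icc_mem_nhds (by norm_num) (by norm_num))
  have h1 := hd.sin
  have h2 : HasDerivAt (fun t => Real.sin (θ t)) 0 (1 / 2) := by
    refine (hasDerivAt_const _ (0 : ℝ)).congr_of_eventuallyEq ?_
    filter_upwards [Ioo_mem_nhds hm.1 hm.2] with t ht using hz t ht
  have h3 := h1.unique h2
  rw [hz _ hm] at h3
  have h4 := Real.sin_sq_add_cos_sq (θ (1 / 2))
  rw [hz _ hm] at h4
  norm_num at h3
  norm_num at h4
  rcases h4 with h4 | h4 <;> norm_num [h4] at h3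

lemma lt_of_forall_lt (h₁ : IsPrufer q₁ θ₁) (h₂ : IsPrufer q₂ θ₂)
    (hq : ContinuousOn q₁ (Icc (-1 : ℝ) 1)) (hlt : ∀ t ∈ Icc (-1 : ℝ) 1, q₁ t < q₂ t)
    (h0 : θ₁ 0 ≤ θ₂ 0) : θ₁ 1 < θ₂ 1 := by
  obtain ⟨s, hs, hne⟩ := h₂.exists_sin_ne_zero
  refine prufer_lt_of_deriv_lt (hq.mono (Icc_subset_Icc (by norm_num) le_rfl))
    (h₁.hasDerivWithinAt_sub (by norm_num) le_rfl) (h₂.hasDerivWithinAt_sub (by norm_num) le_rfl)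
    (fun t ht => ?_) ⟨s, hs, ?_⟩ h0
  · have := mul_nonneg (sub_nonneg.2 (hlt t ⟨by linarith [ht.1], ht.2⟩).le)
      (sq_nonneg (Real.sin (θ₂ t)))
    linarith
  · have := mul_pos (sub_pos.2 (hlt s ⟨by linarith [hs.1], hs.2.le⟩)) (sq_pos_of_ne_zero hne)
    linarith

lemma add_pi (h : IsPrufer q θ) : IsPrufer q (fun t => θ t + Real.pi) := by
  intro t ht
  refine ((h t ht).add_const Real.pi).congr_deriv ?_
  rw [Real.sin_add_pi, neg_sq]

/-- A Grönwall estimate: the integrating factor lies between `exp (-C)` and `exp C`, and using it in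
both directions costs `exp (2 * C)`. It yields continuity of the final angle in the spectral
parameter. -/
lemma abs_sub_le (h₁ : IsPrufer q₁ θ₁) (h₂ : IsPrufer q₂ θ₂)
    (hq : ContinuousOn q₁ (Icc (-1 : ℝ) 1)) {C ε : ℝ} (hC : ∀ t ∈ Icc (-1 : ℝ) 1, |q₁ t| ≤ C)
    (hε : ∀ t ∈ Icc (-1 : ℝ) 1, |q₂ t - q₁ t| ≤ ε) (h0 : θ₁ 0 = θ₂ 0) :
    |θ₂ 1 - θ₁ 1| ≤ Real.exp (2 * C) * ε := by
  have hsub : Icc (0 : ℝ) 1 ⊆ Icc (-1) 1 := Icc_subset_Icc (by norm_num) le_rfl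
  obtain ⟨A, hAb, hA⟩ := exists_integrating_factor (zero_le_one (α := ℝ)) (hq.mono hsub)
    (fun t ht => hC t (hsub ht)) (h₁.hasDerivWithinAt_sub (by norm_num) le_rfl)
    (h₂.hasDerivWithinAt_sub (by norm_num) le_rfl)
  simp only [sub_zero, mul_one] at hAb
  have key := (convex_Icc (0 : ℝ) 1).norm_image_sub_le_of_norm_hasDerivWithin_le
    (C := Real.exp C * ε) hA (fun t ht => by
      have e : 1 + q₂ t * Real.sin (θ₂ t) ^ 2 - (1 + q₁ t * Real.sin (θ₁ t) ^ 2) -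
          q₁ t * (Real.sin (θ₂ t) ^ 2 - Real.sin (θ₁ t) ^ 2) =
          (q₂ t - q₁ t) * Real.sin (θ₂ t) ^ 2 := by ring
      rw [e, Real.norm_eq_abs, abs_mul, abs_mul, Real.abs_exp,
        abs_of_nonneg (sq_nonneg (Real.sin (θ₂ t)))]
      have h1 := hε t (hsub ht)
      have h2 := (abs_le.1 (hAb t ht)).2
      have h3 := Real.sin_sq_le_one (θ₂ t)
      calc Real.exp (A t) * (|q₂ t - q₁ t| * Real.sin (θ₂ t) ^ 2)
          ≤ Real.exp C * (ε * 1) := by gcongr; exact (abs_nonneg _).trans h1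
        _ = _ := by ring)
    (left_mem_Icc.2 zero_le_one) (right_mem_Icc.2 zero_le_one)
  rw [h0, sub_self, mul_zero, sub_zero, Real.norm_eq_abs, abs_mul, Real.abs_exp] at key
  have h1 := (abs_le.1 (hAb 1 (right_mem_Icc.2 zero_le_one))).1
  have h2 : 1 ≤ Real.exp C * Real.exp (A 1) := by
    rw [← Real.exp_add]; exact Real.one_le_exp (by linarith)
  calc |θ₂ 1 - θ₁ 1| ≤ (Real.exp C * Real.exp (A 1)) * |θ₂ 1 - θ₁ 1| :=
        le_mul_of_one_le_left (abs_nonneg _) h2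
    _ = Real.exp C * (Real.exp (A 1) * |θ₂ 1 - θ₁ 1|) := by ring
    _ ≤ Real.exp C * (Real.exp C * ε) := by
        refine mul_le_mul_of_nonneg_left ?_ (Real.exp_pos _).le
        simpa only [sub_zero, norm_one, mul_one] using key
    _ = _ := by rw [two_mul, Real.exp_add]; ring

end IsPrufer

/-! ### Solutions of the Schrödinger equation -/

/-- `u`, with derivative `du`, solves `-u'' + Q u = μ u` on `S`. -/
def IsSol (S : Set ℝ) (Q : ℝ → ℝ) (μ : ℝ) (u du : ℝ → ℝ) : Prop :=
  ∀ t ∈ S, HasDerivWithinAt u (du t) S t ∧ HasDerivWithinAt du ((Q t - μ) * u t) S t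

/-- The Dirichlet eigenvalues of `-u'' + Q u` on `[-1, 1]`. -/
def schrodingerEigenvalues (Q : ℝ → ℝ) : Set ℝ :=
  {μ | ∃ u du, IsSol (Icc (-1) 1) Q μ u du ∧ u (-1) = 0 ∧ u 1 = 0 ∧ ∃ t ∈ Icc (-1 : ℝ) 1, u t ≠ 0}

/-- `u` and `v` are, on `[0, 1]`, eigenfunctions of an even potential for its first two
eigenvalues `μ` and `ν`. -/
structure IsGapData (Q : ℝ → ℝ) (μ ν : ℝ) (u du v dv : ℝ → ℝ) : Prop where
  sol_fst : IsSol (Icc 0 1) Q μ u du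
  sol_snd : IsSol (Icc 0 1) Q ν v dv
  lt : μ < ν
  fst_pos : ∀ t ∈ Ico (0 : ℝ) 1, 0 < u t
  fst_one : u 1 = 0
  deriv_fst_zero : du 0 = 0
  snd_pos : ∀ t ∈ Ioo (0 : ℝ) 1, 0 < v t
  snd_zero : v 0 = 0
  snd_one : v 1 = 0
  deriv_snd_zero : 0 < dv 0
  deriv_snd_one : dv 1 ≠ 0

lemma eq_of_deriv_zero {a b : ℝ} {f : ℝ → ℝ}
    (h : ∀ t ∈ Icc a b, HasDerivWithinAt f 0 (Icc a b) t) {s t : ℝ} (hs : s ∈ Icc a b)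
    (ht : t ∈ Icc a b) : f t = f s := by
  have := (convex_Icc a b).norm_image_sub_le_of_norm_hasDerivWithin_le (C := 0) h
    (fun _ _ => by simp) hs ht
  rw [zero_mul, norm_le_zero_iff, sub_eq_zero] at this
  exact this

namespace IsSol

variable {S T : Set ℝ} {Q : ℝ → ℝ} {μ : ℝ} {u du v dv : ℝ → ℝ}

lemma mono (h : IsSol S Q μ u du) (hT : T ⊆ S) : IsSol T Q μ u du :=
  fun t ht => ⟨(h t (hT ht)).1.mono hT, (h t (hT ht)).2.mono hT⟩

lemma comp_neg (h : IsSol (Icc (-1) 1) Q μ u du) (hQ : ∀ t ∈ Icc (-1 : ℝ) 1, Q (-t) = Q t) :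
    IsSol (Icc (-1) 1) Q μ (fun t => u (-t)) (fun t => -du (-t)) := by
  intro t ht
  have ht' : -t ∈ Icc (-1 : ℝ) 1 := ⟨by linarith [ht.2], by linarith [ht.1]⟩
  have hmaps : MapsTo (fun t : ℝ => -t) (Icc (-1) 1) (Icc (-1) 1) :=
    fun s hs => ⟨by linarith [hs.2], by linarith [hs.1]⟩
  have hn : HasDerivWithinAt (fun t : ℝ => -t) (-1) (Icc (-1) 1) t := hasDerivWithinAt_neg t _
  constructor
  · exact ((h _ ht').1.comp t hn hmaps).congr_deriv (by ring)
  · refine ((h _ ht').2.comp t hn hmaps).neg.congr_deriv ?_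
    rw [hQ t ht]; ring

lemma wronskian_eq (hu : IsSol (Icc (-1) 1) Q μ u du) (hv : IsSol (Icc (-1) 1) Q μ v dv)
    {t : ℝ} (ht : t ∈ Icc (-1 : ℝ) 1) : u t * dv t - du t * v t = u 0 * dv 0 - du 0 * v 0 := by
  refine eq_of_deriv_zero (f := fun t => u t * dv t - du t * v t) (fun s hs => ?_)
    (show (0 : ℝ) ∈ Icc (-1 : ℝ) 1 by norm_num) ht
  exact (((hu s hs).1.mul (hv s hs).2).sub ((hu s hs).2.mul (hv s hs).1)).congr_deriv (by ring)

/-- Every solution is a combination of the normalized even and odd solutions. -/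
lemma eq_combination {e de o do' : ℝ → ℝ} (h : IsSol (Icc (-1) 1) Q μ u du)
    (he : IsSol (Icc (-1) 1) Q μ e de) (ho : IsSol (Icc (-1) 1) Q μ o do')
    (e0 : e 0 = 1) (de0 : de 0 = 0) (o0 : o 0 = 0) (do0 : do' 0 = 1) {t : ℝ}
    (ht : t ∈ Icc (-1 : ℝ) 1) : u t = u 0 * e t + du 0 * o t := by
  have h1 := wronskian_eq h ho ht
  have h2 := wronskian_eq h he ht
  have h3 := wronskian_eq he ho ht
  rw [e0, de0, o0, do0] at h3
  rw [o0, do0] at h1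
  rw [e0, de0] at h2
  -- Eliminating the derivatives from the three Wronskians; that of `e` and `o` equals one.
  linear_combination (-u t) * h3 + e t * h1 - o t * h2

end IsSol

/-- The solution with a given Prüfer angle. -/
lemma IsPrufer.exists_isSol {Q θ : ℝ → ℝ} {μ : ℝ} (hQ : ContinuousOn Q (Icc (-1 : ℝ) 1))
    (h : IsPrufer (fun t => μ - Q t - 1) θ) :
    ∃ r : ℝ → ℝ, r 0 = 1 ∧ (∀ t, 0 < r t) ∧ IsSol (Icc (-1) 1) Q μ
      (fun t => r t * Real.sin (θ t)) (fun t => r t * Real.cos (θ t)) := by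
  -- This is the logarithmic derivative of the amplitude `r` in `u = r sin θ`, `u' = r cos θ`.
  have hc : ContinuousOn (fun t => (1 - μ + Q t) * (Real.sin (θ t) * Real.cos (θ t)))
      (Icc (-1 : ℝ) 1) :=
    (continuousOn_const.add hQ).mul ((Real.continuous_sin.comp_continuousOn h.continuousOn).mul
      (Real.continuous_cos.comp_continuousOn h.continuousOn))
  obtain ⟨C, hC⟩ := isCompact_Icc.exists_bound_of_continuousOn hc
  obtain ⟨F, hF0, hF, -⟩ :=
    exists_antideriv (show (0 : ℝ) ∈ Icc (-1 : ℝ) 1 by norm_num) hc hC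
  refine ⟨fun t => Real.exp (F t), by simp [hF0], fun t => Real.exp_pos _, fun t ht => ⟨?_, ?_⟩⟩
  · refine ((hF t ht).exp.mul (h t ht).sin).congr_deriv ?_
    ring
  · refine ((hF t ht).exp.mul (h t ht).cos).congr_deriv ?_
    have := Real.sin_sq_add_cos_sq (θ t)
    linear_combination Real.exp (F t) * Real.sin (θ t) * (1 - μ + Q t) * this

/-! ### The first two Dirichlet eigenvalues by shooting from the center -/

lemma exists_int_mul_pi {x : ℝ} (hx : 0 < x) (h : Real.sin x = 0) :
    ∃ k : ℤ, 1 ≤ k ∧ k * Real.pi = x := by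
  obtain ⟨k, hk⟩ := Real.sin_eq_zero_iff.1 h
  refine ⟨k, ?_, hk⟩
  by_contra! hlt
  have : (k : ℝ) ≤ 0 := by exact_mod_cast Int.lt_add_one_iff.1 hlt
  nlinarith [Real.pi_pos]

/-- For the free equation with `μ = π²` the odd Prüfer angle reaches at least `π`. -/
lemma pi_le_free_prufer {θ : ℝ → ℝ} (h : IsPrufer (fun _ => Real.pi ^ 2 - 0 - 1) θ)
    (h0 : θ 0 = 0) : Real.pi ≤ θ 1 := by
  have hpos : 0 < θ 1 := by
    have := h.int_mul_pi_lt continuousOn_const (a := 0) (k := 0) (by norm_num) one_pos le_rfl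
      (by simp [h0])
    simpa using this
  obtain ⟨r, hr0, hr, hsol⟩ := IsPrufer.exists_isSol (Q := fun _ => 0) continuousOn_const h
  have hs : IsSol (Icc (-1) 1) (fun _ => 0) (Real.pi ^ 2) (fun t => Real.sin (Real.pi * t))
      (fun t => Real.pi * Real.cos (Real.pi * t)) := by
    intro t _
    have hl : HasDerivWithinAt (fun t : ℝ => Real.pi * t) Real.pi (Icc (-1) 1) t := by
      simpa using (hasDerivWithinAt_id t (Icc (-1 : ℝ) 1)).const_mul Real.pi
    exact ⟨hl.sin.congr_deriv (by ring), (hl.cos.const_mul _).congr_deriv (by ring)⟩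
  -- Both solutions vanish at `0`, so the Wronskian is zero; since `sin (π t)` vanishes at `1`, so
  -- does the Prüfer solution.
  have hw := IsSol.wronskian_eq hsol hs (show (1 : ℝ) ∈ Icc (-1 : ℝ) 1 by norm_num)
  simp only [h0, mul_one, Real.sin_pi, Real.cos_pi, Real.sin_zero, mul_zero] at hw
  have hsin : Real.sin (θ 1) = 0 := by
    have h1 : r 1 * Real.pi * Real.sin (θ 1) = 0 := by linear_combination -hw
    have h2 : r 1 * Real.pi ≠ 0 := (mul_pos (hr 1) Real.pi_pos).ne'
    exact (mul_eq_zero.1 h1).resolve_left h2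
  obtain ⟨k, hk, hkx⟩ := exists_int_mul_pi hpos hsin
  rw [← hkx]
  have : (1 : ℝ) ≤ k := by exact_mod_cast hk
  nlinarith [Real.pi_pos]

/-- If the Prüfer angle starts in `[0, π)` and ends at `π`, it stays in `(0, π)` in between. -/
lemma IsPrufer.sin_pos {q θ : ℝ → ℝ} (h : IsPrufer q θ) (hq : ContinuousOn q (Icc (-1 : ℝ) 1))
    (h0 : 0 ≤ θ 0) (h1 : θ 1 = Real.pi) {t : ℝ} (ht : t ∈ Ioo (0 : ℝ) 1) :
    0 < Real.sin (θ t) := by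
  apply Real.sin_pos_of_pos_of_lt_pi
  · have := h.int_mul_pi_lt hq (a := 0) (k := 0) (by norm_num) ht.1 ht.2.le (by simpa using h0)
    simpa using this
  · by_contra! hge
    have := h.int_mul_pi_lt hq (a := t) (b := 1) (k := 1) (by linarith [ht.1]) ht.2 le_rfl
      (by simpa using hge)
    simp [h1] at this

/-- The first two Dirichlet eigenvalues of an even potential. -/
theorem exists_isGapData {Q : ℝ → ℝ} (hQ : ContinuousOn Q (Icc (-1 : ℝ) 1))
    (hev : ∀ t ∈ Icc (-1 : ℝ) 1, Q (-t) = Q t) :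
    ∃ μ ν u du v dv, IsGapData Q μ ν u du v dv ∧ IsLeast (schrodingerEigenvalues Q) μ ∧
      IsLeast (schrodingerEigenvalues Q ∩ Ioi μ) ν := by
  have hq : ∀ μ, ContinuousOn (fun t => μ - Q t - 1) (Icc (-1 : ℝ) 1) := fun μ =>
    (continuousOn_const.sub hQ).sub continuousOn_const
  obtain ⟨M, hM⟩ := isCompact_Icc.exists_bound_of_continuousOn hQ
  have one_mem : (1 : ℝ) ∈ Icc (-1 : ℝ) 1 := by norm_num
  have neg_one_mem : (-1 : ℝ) ∈ Icc (-1 : ℝ) 1 := by norm_num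
  have hsub : Icc (0 : ℝ) 1 ⊆ Icc (-1) 1 := Icc_subset_Icc (by norm_num) le_rfl
  choose θ hθ0 hθ using fun (θ₀ μ : ℝ) => exists_isPrufer (hq μ) θ₀
  have hpi := Real.pi_pos
  have hmono : ∀ θ₀, StrictMono fun μ => θ θ₀ μ 1 := fun θ₀ μ ν hμν =>
    (hθ θ₀ μ).lt_of_forall_lt (hθ θ₀ ν) (hq μ) (fun t _ => by linarith) (by simp [hθ0])
  have hcont : ∀ θ₀, Continuous fun μ => θ θ₀ μ 1 := by
    intro θ₀
    rw [continuous_iff_continuousAt]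
    intro μ
    obtain ⟨C, hC⟩ := isCompact_Icc.exists_bound_of_continuousOn (hq μ)
    rw [ContinuousAt, tendsto_iff_dist_tendsto_zero]
    refine squeeze_zero (fun _ => dist_nonneg) (g := fun ν => Real.exp (2 * C) * |ν - μ|)
      (fun ν => ?_) ?_
    · rw [Real.dist_eq]
      refine (hθ θ₀ μ).abs_sub_le (hθ θ₀ ν) (hq μ) hC (fun t _ => le_of_eq ?_) (by simp [hθ0])
      congr 1; ring
    · have : Continuous fun ν => Real.exp (2 * C) * |ν - μ| := by fun_prop
      simpa using this.tendsto μ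
  have hpos : ∀ θ₀, 0 ≤ θ₀ → ∀ μ, 0 < θ θ₀ μ 1 := by
    intro θ₀ h0 μ
    have := (hθ θ₀ μ).int_mul_pi_lt (hq μ) (a := 0) (k := 0) (by norm_num) one_pos le_rfl
      (by simpa [hθ0] using h0)
    simpa using this
  have hsurj : ∀ θ₀, 0 ≤ θ₀ → θ₀ ≤ Real.pi / 2 → ∃ μ, θ θ₀ μ 1 = Real.pi := by
    intro θ₀ h0 h1
    -- With `M` a bound for `|Q|`, the parameter `-M` makes the Prüfer coefficient at most `-1`,
    -- while `M + π²` makes it at least that of the free equation at `π²`.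
    have hlow : θ θ₀ (-M) 1 ≤ Real.pi := by
      have := (hθ θ₀ (-M)).le_pi_div_two (hq _)
        (fun t ht => by have := (abs_le.1 (hM t ht)).1; linarith) (by simpa [hθ0] using h1)
      linarith
    have hhigh : Real.pi ≤ θ θ₀ (M + Real.pi ^ 2) 1 := by
      obtain ⟨φ, hφ0, hφ⟩ := exists_isPrufer (q := fun _ => Real.pi ^ 2 - 0 - 1)
        continuousOn_const 0
      refine (pi_le_free_prufer hφ hφ0).trans ?_
      refine hφ.le_of_le (hθ _ _) continuousOn_const (fun t ht => ?_) (by simpa [hφ0, hθ0] using h0)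
      have := (abs_le.1 (hM t ht)).2
      linarith
    obtain ⟨μ, -, hμ⟩ := intermediate_value_Icc
      (show -M ≤ M + Real.pi ^ 2 by
        have := (norm_nonneg _).trans (hM 1 one_mem)
        nlinarith) (hcont θ₀).continuousOn ⟨hlow, hhigh⟩
    exact ⟨μ, hμ⟩
  have hsol : ∀ θ₀ μ, ∃ r : ℝ → ℝ, r 0 = 1 ∧ (∀ t, 0 < r t) ∧ IsSol (Icc (-1) 1) Q μ
      (fun t => r t * Real.sin (θ θ₀ μ t)) (fun t => r t * Real.cos (θ θ₀ μ t)) :=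
    fun θ₀ μ => (hθ θ₀ μ).exists_isSol hQ
  choose r hr0 hr hs using hsol
  set e : ℝ → ℝ → ℝ := fun μ t => r (Real.pi / 2) μ t * Real.sin (θ (Real.pi / 2) μ t) with he
  set de : ℝ → ℝ → ℝ := fun μ t => r (Real.pi / 2) μ t * Real.cos (θ (Real.pi / 2) μ t) with hde
  set o : ℝ → ℝ → ℝ := fun μ t => r 0 μ t * Real.sin (θ 0 μ t) with ho
  set d : ℝ → ℝ → ℝ := fun μ t => r 0 μ t * Real.cos (θ 0 μ t) with hd
  have hes : ∀ μ, IsSol (Icc (-1) 1) Q μ (e μ) (de μ) := fun μ => hs _ μ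
  have hos : ∀ μ, IsSol (Icc (-1) 1) Q μ (o μ) (d μ) := fun μ => hs _ μ
  have e0 : ∀ μ, e μ 0 = 1 := fun μ => by simp [he, hr0, hθ0]
  have de0 : ∀ μ, de μ 0 = 0 := fun μ => by simp [hde, hr0, hθ0]
  have o0 : ∀ μ, o μ 0 = 0 := fun μ => by simp [ho, hθ0]
  have d0 : ∀ μ, d μ 0 = 1 := fun μ => by simp [hd, hr0, hθ0]
  have comb : ∀ {μ u du}, IsSol (Icc (-1) 1) Q μ u du → ∀ {t}, t ∈ Icc (-1 : ℝ) 1 →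
      u t = u 0 * e μ t + du 0 * o μ t := fun h _ ht =>
    h.eq_combination (hes _) (hos _) (e0 _) (de0 _) (o0 _) (d0 _) ht
  have he_neg : ∀ μ, e μ (-1) = e μ 1 := fun μ => by
    have := comb ((hes μ).comp_neg hev) one_mem
    simpa [e0, de0] using this
  have ho_neg : ∀ μ, o μ (-1) = -o μ 1 := fun μ => by
    have := comb ((hos μ).comp_neg hev) one_mem
    simpa [o0, d0] using this
  have e_zero_iff : ∀ μ, e μ 1 = 0 ↔ Real.sin (θ (Real.pi / 2) μ 1) = 0 := fun μ => by
    simp [he, (hr _ μ 1).ne']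
  have o_zero_iff : ∀ μ, o μ 1 = 0 ↔ Real.sin (θ 0 μ 1) = 0 := fun μ => by
    simp [ho, (hr _ μ 1).ne']
  have mem_iff : ∀ μ, μ ∈ schrodingerEigenvalues Q ↔ e μ 1 = 0 ∨ o μ 1 = 0 := by
    intro μ
    constructor
    · rintro ⟨u, du, hu, hu1, hu2, t, ht, hne⟩
      have h1 := comb hu neg_one_mem
      have h2 := comb hu one_mem
      rw [hu1, he_neg, ho_neg] at h1
      rw [hu2] at h2
      have h3 : u 0 * e μ 1 = 0 := by linarith
      have h4 : du 0 * o μ 1 = 0 := by linarith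
      rcases mul_eq_zero.1 h3 with h3 | h3
      · rcases mul_eq_zero.1 h4 with h4 | h4
        · exact absurd (by rw [comb hu ht, h3, h4]; ring) hne
        · exact Or.inr h4
      · exact Or.inl h3
    · rintro (h | h)
      · exact ⟨e μ, de μ, hes μ, by rw [he_neg, h], h, 0, by norm_num, by simp [e0]⟩
      · refine ⟨o μ, d μ, hos μ, by rw [ho_neg, h, neg_zero], h, ?_⟩
        by_contra! hz
        have h1 := ((hos μ) 0 (by norm_num)).1.hasDerivAt
          (Icc_mem_nhds (by norm_num) (by norm_num))
        have h2 : HasDerivAt (o μ) 0 0 := by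
          refine (hasDerivAt_const _ (0 : ℝ)).congr_of_eventuallyEq ?_
          filter_upwards [Icc_mem_nhds (show (-1 : ℝ) < 0 by norm_num) one_pos] with t ht
            using hz t ht
        have := h1.unique h2
        rw [d0] at this
        exact one_ne_zero this
  obtain ⟨μ, hμ⟩ := hsurj (Real.pi / 2) (by positivity) le_rfl
  obtain ⟨ν, hν⟩ := hsurj 0 le_rfl (by positivity)
  have hle_of_e : ∀ {l}, e l 1 = 0 → μ ≤ l := by
    intro l hl
    obtain ⟨k, hk, hkx⟩ := exists_int_mul_pi (hpos _ (by positivity) l) ((e_zero_iff l).1 hl)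
    refine (hmono (Real.pi / 2)).le_iff_le.1 ?_
    have : (1 : ℝ) ≤ k := by exact_mod_cast hk
    simp only [hμ, ← hkx]
    nlinarith
  have hle_of_o : ∀ {l}, o l 1 = 0 → ν ≤ l := by
    intro l hl
    obtain ⟨k, hk, hkx⟩ := exists_int_mul_pi (hpos _ le_rfl l) ((o_zero_iff l).1 hl)
    refine (hmono 0).le_iff_le.1 ?_
    have : (1 : ℝ) ≤ k := by exact_mod_cast hk
    simp only [hν, ← hkx]
    nlinarith
  -- At `ν` the even angle starts above the odd one, which ends at `π`; so the even angle has
  -- already passed `π`, which it reaches exactly at `μ`.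
  have hμν : μ < ν := by
    refine (hmono (Real.pi / 2)).lt_iff_lt.1 ?_
    have h := (hθ 0 ν).lt_of_lt (hθ (Real.pi / 2) ν) (hq ν) (by simp only [hθ0]; positivity)
    rw [hν] at h
    simpa only [hμ] using h
  -- The odd angle shifted by `π` starts above the even one and ends at `2π`. Hence the next even
  -- eigenvalue, where the even angle ends at `2π` or more, lies beyond `ν`.
  have hν_lt : θ (Real.pi / 2) ν 1 < 2 * Real.pi := by
    have := (hθ (Real.pi / 2) ν).lt_of_lt (hθ 0 ν).add_pi (hq ν) (by simp only [hθ0]; linarith)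
    rw [hν] at this
    linarith
  refine ⟨μ, ν, e μ, de μ, o ν, d ν, ?_, ⟨?_, ?_⟩, ⟨⟨?_, hμν⟩, ?_⟩⟩
  · have e1 : e μ 1 = 0 := by rw [e_zero_iff, hμ, Real.sin_pi]
    have o1 : o ν 1 = 0 := by rw [o_zero_iff, hν, Real.sin_pi]
    refine ⟨(hes μ).mono hsub, (hos ν).mono hsub, hμν, fun t ht => ?_, e1, de0 μ, fun t ht => ?_,
      o0 ν, o1, by rw [d0]; exact one_pos, ?_⟩
    · rcases ht.1.eq_or_lt with h | h
      · rw [← h, e0]; exact one_pos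
      · exact mul_pos (hr _ _ _) ((hθ _ μ).sin_pos (hq μ) (by rw [hθ0]; positivity) hμ ⟨h, ht.2⟩)
    · exact mul_pos (hr _ _ _) ((hθ _ ν).sin_pos (hq ν) (by rw [hθ0]) hν ht)
    · simp [hd, hν, (hr 0 ν 1).ne']
  · rw [mem_iff, e_zero_iff, hμ, Real.sin_pi]; exact Or.inl rfl
  · intro l hl
    rcases (mem_iff l).1 hl with h | h
    · exact hle_of_e h
    · exact hμν.le.trans (hle_of_o h)
  · rw [mem_iff, o_zero_iff, hν, Real.sin_pi]; exact Or.inr rfl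
  · rintro l ⟨hl, hlμ⟩
    rcases (mem_iff l).1 hl with h | h
    · obtain ⟨k, hk, hkx⟩ := exists_int_mul_pi (hpos _ (by positivity) l) ((e_zero_iff l).1 h)
      have h1 : θ (Real.pi / 2) μ 1 < θ (Real.pi / 2) l 1 := hmono _ hlμ
      rw [hμ, ← hkx] at h1
      have h2 : (1 : ℝ) < k := by nlinarith
      have h3 : (2 : ℝ) ≤ k := by
        have : (1 : ℤ) < k := by exact_mod_cast h2
        exact_mod_cast this
      refine ((hmono (Real.pi / 2)).lt_iff_lt.1 (show _ < _ from ?_)).le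
      simp only [← hkx]
      nlinarith
    · exact hle_of_o h

/-! ### Wronskians of two equations and limits at common zeros -/

namespace IsSol

variable {a b : ℝ} {Q R : ℝ → ℝ} {μ ν : ℝ} {u du v dv : ℝ → ℝ}

lemma hasDerivAt (h : IsSol (Icc a b) Q μ u du) {t : ℝ} (ht : t ∈ Ioo a b) :
    HasDerivAt u (du t) t ∧ HasDerivAt du ((Q t - μ) * u t) t :=
  ⟨(h t (Ioo_subset_Icc_self ht)).1.hasDerivAt (Icc_mem_nhds ht.1 ht.2),
    (h t (Ioo_subset_Icc_self ht)).2.hasDerivAt (Icc_mem_nhds ht.1 ht.2)⟩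

lemma hasDerivWithinAt_wronskian (hu : IsSol (Icc a b) Q μ u du) (hv : IsSol (Icc a b) R ν v dv)
    {t : ℝ} (ht : t ∈ Icc a b) :
    HasDerivWithinAt (fun t => du t * v t - u t * dv t)
      (((Q t - μ) - (R t - ν)) * (u t * v t)) (Icc a b) t :=
  (((hu t ht).2.mul (hv t ht).1).sub ((hu t ht).1.mul (hv t ht).2)).congr_deriv (by ring)

lemma hasDerivAt_wronskian (hu : IsSol (Icc a b) Q μ u du) (hv : IsSol (Icc a b) R ν v dv)
    {t : ℝ} (ht : t ∈ Ioo a b) :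
    HasDerivAt (fun t => du t * v t - u t * dv t)
      (((Q t - μ) - (R t - ν)) * (u t * v t)) t :=
  (hasDerivWithinAt_wronskian hu hv (Ioo_subset_Icc_self ht)).hasDerivAt (Icc_mem_nhds ht.1 ht.2)

lemma tendsto_left (h : IsSol (Icc a b) Q μ u du) (hab : a < b) :
    Tendsto u (𝓝[>] a) (𝓝 (u a)) ∧ Tendsto du (𝓝[>] a) (𝓝 (du a)) := by
  have hm : 𝓝[>] a ≤ 𝓝[Icc a b] a := nhdsWithin_le_of_mem (Icc_mem_nhdsGT hab)
  have ha := h a (left_mem_Icc.2 hab.le)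
  exact ⟨ha.1.continuousWithinAt.tendsto.mono_left hm, ha.2.continuousWithinAt.tendsto.mono_left hm⟩

lemma tendsto_right (h : IsSol (Icc a b) Q μ u du) (hab : a < b) :
    Tendsto u (𝓝[<] b) (𝓝 (u b)) ∧ Tendsto du (𝓝[<] b) (𝓝 (du b)) := by
  have hm : 𝓝[<] b ≤ 𝓝[Icc a b] b := nhdsWithin_le_of_mem (Icc_mem_nhdsLT hab)
  have hb := h b (right_mem_Icc.2 hab.le)
  exact ⟨hb.1.continuousWithinAt.tendsto.mono_left hm, hb.2.continuousWithinAt.tendsto.mono_left hm⟩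

/-- Quotients of solutions have limits at a simple zero. -/
lemma tendsto_div_left (hu : IsSol (Icc a b) Q μ u du) (hv : IsSol (Icc a b) R ν v dv)
    (hab : a < b) (u0 : u a = 0) (v0 : v a = 0) (dv0 : dv a ≠ 0) :
    Tendsto (fun t => u t / v t) (𝓝[>] a) (𝓝 (du a / dv a)) := by
  have hI : ∀ᶠ t in 𝓝[>] a, t ∈ Ioo a b := Ioo_mem_nhdsGT hab
  refine HasDerivAt.lhopital_zero_nhdsGT (f' := du) (g' := dv)
    (hI.mono fun t ht => (hu.hasDerivAt ht).1) (hI.mono fun t ht => (hv.hasDerivAt ht).1)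
    ((hv.tendsto_left hab).2.eventually_ne dv0) ?_ ?_
    ((hu.tendsto_left hab).2.div (hv.tendsto_left hab).2 dv0)
  · simpa [u0] using (hu.tendsto_left hab).1
  · simpa [v0] using (hv.tendsto_left hab).1

lemma tendsto_div_right (hu : IsSol (Icc a b) Q μ u du) (hv : IsSol (Icc a b) R ν v dv)
    (hab : a < b) (u0 : u b = 0) (v0 : v b = 0) (dv0 : dv b ≠ 0) :
    Tendsto (fun t => u t / v t) (𝓝[<] b) (𝓝 (du b / dv b)) := by
  have hI : ∀ᶠ t in 𝓝[<] b, t ∈ Ioo a b := Ioo_mem_nhdsLT hab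
  refine HasDerivAt.lhopital_zero_nhdsLT (f' := du) (g' := dv)
    (hI.mono fun t ht => (hu.hasDerivAt ht).1) (hI.mono fun t ht => (hv.hasDerivAt ht).1)
    ((hv.tendsto_right hab).2.eventually_ne dv0) ?_ ?_
    ((hu.tendsto_right hab).2.div (hv.tendsto_right hab).2 dv0)
  · simpa [u0] using (hu.tendsto_right hab).1
  · simpa [v0] using (hv.tendsto_right hab).1

/-- The Wronskian of two solutions vanishes to order higher than two at a common simple zero. -/
lemma tendsto_wronskian_div_sq (hu : IsSol (Icc a b) Q μ u du) (hv : IsSol (Icc a b) R ν v dv)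
    (hab : a < b) (hQ : ContinuousOn Q (Icc a b)) (hR : ContinuousOn R (Icc a b))
    (hvpos : ∀ t ∈ Ioo a b, v t ≠ 0) (u0 : u a = 0) (v0 : v a = 0) (dv0 : dv a ≠ 0) :
    Tendsto (fun t => (du t * v t - u t * dv t) / v t ^ 2) (𝓝[>] a) (𝓝 0) := by
  have hI : ∀ᶠ t in 𝓝[>] a, t ∈ Ioo a b := Ioo_mem_nhdsGT hab
  have hm : 𝓝[>] a ≤ 𝓝[Icc a b] a := nhdsWithin_le_of_mem (Icc_mem_nhdsGT hab)
  have ha := left_mem_Icc.2 hab.le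
  obtain ⟨tu, tdu⟩ := hu.tendsto_left hab
  obtain ⟨tv, tdv⟩ := hv.tendsto_left hab
  have tQ : Tendsto Q (𝓝[>] a) (𝓝 (Q a)) := (hQ a ha).tendsto.mono_left hm
  have tR : Tendsto R (𝓝[>] a) (𝓝 (R a)) := (hR a ha).tendsto.mono_left hm
  have hne := tdv.eventually_ne dv0
  refine HasDerivAt.lhopital_zero_nhdsGT
    (f' := fun t => ((Q t - μ) - (R t - ν)) * (u t * v t)) (g' := fun t => 2 * v t * dv t)
    (hI.mono fun t ht => hasDerivAt_wronskian hu hv ht)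
    (hI.mono fun t ht => ((hv.hasDerivAt ht).1.pow 2).congr_deriv (by simp)) ?_ ?_ ?_ ?_
  · filter_upwards [hI, hne] with t ht h
    exact mul_ne_zero (mul_ne_zero two_ne_zero (hvpos t ht)) h
  · simpa [u0, v0] using (tdu.mul tv).sub (tu.mul tdv)
  · simpa [v0] using tv.pow 2
  -- One factor `v` cancels in the quotient of derivatives; the remaining factor `u` tends to zero
  -- while `dv` does not.
  · have key : Tendsto (fun t => ((Q t - μ) - (R t - ν)) * u t / (2 * dv t)) (𝓝[>] a) (𝓝 0) := by
      have := (((tQ.sub_const μ).sub (tR.sub_const ν)).mul tu).div (tdv.const_mul 2)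
        (mul_ne_zero two_ne_zero dv0)
      simpa [u0, Pi.div_def] using this
    refine key.congr' ?_
    filter_upwards [hI, hne] with t ht h
    have := hvpos t ht
    field_simp

end IsSol

/-! ### Comparison of gaps -/

variable {Q R : ℝ → ℝ} {μ₁ μ₂ ν₁ ν₂ : ℝ} {u du v dv p dp w dw : ℝ → ℝ}

/-- The Wronskian of the second eigenfunctions is nonpositive if the potentials differ by an
increasing function. -/
lemma wronskian_snd_nonpos (h : IsGapData Q μ₁ μ₂ u du v dv) (k : IsGapData R ν₁ ν₂ p dp w dw)
    (hm : MonotoneOn (fun t => R t - Q t) (Icc 0 1)) {t : ℝ} (ht : t ∈ Icc (0 : ℝ) 1) :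
    dw t * v t - w t * dv t ≤ 0 := by
  set f : ℝ → ℝ := fun t => dw t * v t - w t * dv t with hf
  have hd : ∀ s ∈ Icc (0 : ℝ) 1, HasDerivWithinAt f _ (Icc 0 1) s := fun s hs =>
    k.sol_snd.hasDerivWithinAt_wronskian h.sol_snd hs
  have hc : ContinuousOn f (Icc 0 1) := fun s hs => (hd s hs).continuousWithinAt
  have f0 : f 0 = 0 := by simp [hf, h.snd_zero, k.snd_zero]
  have f1 : f 1 = 0 := by simp [hf, h.snd_one, k.snd_one]
  by_contra! hpos
  change 0 < f t at hpos
  have ht0 : 0 < t := ht.1.lt_of_ne (by rintro rfl; linarith)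
  have ht1 : t < 1 := ht.2.lt_of_ne (by rintro rfl; linarith)
  -- The Wronskian vanishes at both ends. A positive value at `t` would give a point with positive
  -- slope followed by one with negative slope, whereas the slope is `R - Q` plus a constant, times
  -- a positive function, and can only change sign upwards.
  obtain ⟨s, hs, hs'⟩ := exists_hasDerivAt_eq_slope f _ ht0
    (hc.mono (Icc_subset_Icc le_rfl ht.2))
    (fun s hs => k.sol_snd.hasDerivAt_wronskian h.sol_snd ⟨hs.1, hs.2.trans ht1⟩)
  obtain ⟨r, hr, hr'⟩ := exists_hasDerivAt_eq_slope f _ ht1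
    (hc.mono (Icc_subset_Icc ht.1 le_rfl))
    (fun s hs => k.sol_snd.hasDerivAt_wronskian h.sol_snd ⟨ht0.trans hs.1, hs.2⟩)
  rw [f0, sub_zero, sub_zero] at hs'
  rw [f1, zero_sub] at hr'
  have hs0 : 0 < (R s - ν₂ - (Q s - μ₂)) * (w s * v s) := hs' ▸ div_pos hpos ht0
  have hr0 : (R r - ν₂ - (Q r - μ₂)) * (w r * v r) < 0 :=
    hr' ▸ div_neg_of_neg_of_pos (neg_lt_zero.2 hpos) (by linarith)
  have ps : 0 < w s * v s :=
    mul_pos (k.snd_pos s ⟨hs.1, hs.2.trans ht1⟩) (h.snd_pos s ⟨hs.1, hs.2.trans ht1⟩)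
  have pr : 0 < w r * v r :=
    mul_pos (k.snd_pos r ⟨ht0.trans hr.1, hr.2⟩) (h.snd_pos r ⟨ht0.trans hr.1, hr.2⟩)
  have h1 := (mul_pos_iff_of_pos_right ps).1 hs0
  have h2 : R r - ν₂ - (Q r - μ₂) < 0 := by
    by_contra! hge
    exact absurd (mul_nonneg hge pr.le) (not_le.2 hr0)
  have h3 : R s - Q s ≤ R r - Q r := hm ⟨hs.1.le, (hs.2.trans ht1).le⟩
    ⟨(ht0.trans hr.1).le, hr.2.le⟩ (hs.2.trans hr.1).le
  linarith

/-- This Wronskian has derivative `(μ₂ - μ₁) u v`, positive inside, and ends at zero. It expresses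
that `v / u` increases. -/
lemma wronskian_fst_snd_neg (h : IsGapData Q μ₁ μ₂ u du v dv) {t : ℝ} (ht : t ∈ Ioo (0 : ℝ) 1) :
    du t * v t - u t * dv t < 0 := by
  set f : ℝ → ℝ := fun t => du t * v t - u t * dv t with hf
  have hmono : MonotoneOn f (Icc 0 1) := by
    refine monotoneOn_of_deriv_Icc (fun s hs =>
      h.sol_fst.hasDerivWithinAt_wronskian h.sol_snd hs) (fun s hs => ?_)
    have hu : 0 ≤ u s := by
      rcases hs.2.eq_or_lt with h1 | h1
      · rw [h1, h.fst_one]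
      · exact (h.fst_pos s ⟨hs.1, h1⟩).le
    have hv : 0 ≤ v s := by
      rcases hs.2.eq_or_lt with h1 | h1
      · rw [h1, h.snd_one]
      rcases hs.1.eq_or_lt with h0 | h0
      · rw [← h0, h.snd_zero]
      · exact (h.snd_pos s ⟨h0, h1⟩).le
    exact mul_nonneg (by linarith [h.lt]) (mul_nonneg hu hv)
  have f1 : f 1 = 0 := by simp [hf, h.fst_one, h.snd_one]
  have hle : ∀ s ∈ Icc (0 : ℝ) 1, f s ≤ 0 := fun s hs =>
    f1 ▸ hmono hs (right_mem_Icc.2 zero_le_one) hs.2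
  refine (hle t (Ioo_subset_Icc_self ht)).lt_of_ne fun h0 => ?_
  have hd := h.sol_fst.hasDerivAt_wronskian h.sol_snd ht
  have hmax : IsLocalMax f t := by
    filter_upwards [Icc_mem_nhds ht.1 ht.2] with s hs
    exact (hle s hs).trans h0.ge
  have := hmax.hasDerivAt_eq_zero hd
  have hp : 0 < (Q t - μ₁ - (Q t - μ₂)) * (u t * v t) :=
    mul_pos (by linarith [h.lt]) (mul_pos (h.fst_pos t ⟨ht.1.le, ht.2⟩) (h.snd_pos t ht))
  linarith

/-- Adding to an even potential a function that increases away from the center does not decrease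
the spectral gap; the hypotheses express the contrary. -/
lemma gap_comparison_aux (h : IsGapData Q μ₁ μ₂ u du v dv) (k : IsGapData R ν₁ ν₂ p dp w dw)
    (hQ : ContinuousOn Q (Icc 0 1)) (hR : ContinuousOn R (Icc 0 1))
    (hm : MonotoneOn (fun t => R t - Q t) (Icc 0 1)) (hle : ν₂ - ν₁ ≤ μ₂ - μ₁) :
    ν₂ - ν₁ = μ₂ - μ₁ ∧ ∀ t ∈ Ioo (0 : ℝ) 1, dw t * v t - w t * dv t = 0 := by
  set W : ℝ → ℝ := fun t => dw t * v t - w t * dv t with hW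
  set S : ℝ → ℝ := fun t => dp t * u t - p t * du t with hS
  -- With `g = p / u` and `h = w / v` one has `S = u² g'` and `W = v² h'`, so this is `u² (h g' - g
  -- h')`. In its derivative the potentials cancel, leaving only the difference of the gaps and a
  -- term with the sign of `W`.
  set F : ℝ → ℝ := fun t => w t / v t * S t - p t * u t * (W t / v t ^ 2) with hF
  set F' : ℝ → ℝ := fun t => w t / v t * (u t * p t) * ((ν₂ - ν₁) - (μ₂ - μ₁)) +
    2 * p t * W t / v t ^ 3 * (u t * dv t - du t * v t) with hF'
  have hd : ∀ t ∈ Ioo (0 : ℝ) 1, HasDerivAt F (F' t) t := by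
    intro t ht
    have hv := (h.snd_pos t ht).ne'
    have hdW : HasDerivAt W _ t := k.sol_snd.hasDerivAt_wronskian h.sol_snd ht
    have hdS : HasDerivAt S _ t := k.sol_fst.hasDerivAt_wronskian h.sol_fst ht
    have dv1 := (h.sol_snd.hasDerivAt ht).1
    have := (((k.sol_snd.hasDerivAt ht).1.div dv1 hv).mul hdS).sub
      (((k.sol_fst.hasDerivAt ht).1.mul (h.sol_fst.hasDerivAt ht).1).mul
        (hdW.div (dv1.pow 2) (pow_ne_zero 2 hv)))
    refine this.congr_deriv ?_
    simp only [hF', hW, hS, Pi.mul_apply, Pi.div_apply, Pi.pow_apply]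
    field_simp
    ring
  have hpos : ∀ t ∈ Ioo (0 : ℝ) 1, 0 < u t ∧ 0 < v t ∧ 0 < p t ∧ 0 < w t := fun t ht =>
    ⟨h.fst_pos t ⟨ht.1.le, ht.2⟩, h.snd_pos t ht, k.fst_pos t ⟨ht.1.le, ht.2⟩, k.snd_pos t ht⟩
  have hWle : ∀ t ∈ Ioo (0 : ℝ) 1, W t ≤ 0 := fun t ht =>
    wronskian_snd_nonpos h k hm (Ioo_subset_Icc_self ht)
  have hterm₁ : ∀ t ∈ Ioo (0 : ℝ) 1,
      w t / v t * (u t * p t) * ((ν₂ - ν₁) - (μ₂ - μ₁)) ≤ 0 := by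
    intro t ht
    obtain ⟨hu, hv, hp, hw⟩ := hpos t ht
    exact mul_nonpos_of_nonneg_of_nonpos (by positivity) (by linarith)
  have hterm₂ : ∀ t ∈ Ioo (0 : ℝ) 1,
      2 * p t * W t / v t ^ 3 * (u t * dv t - du t * v t) ≤ 0 := by
    intro t ht
    obtain ⟨hu, hv, hp, hw⟩ := hpos t ht
    refine mul_nonpos_of_nonpos_of_nonneg (div_nonpos_of_nonpos_of_nonneg
      (mul_nonpos_of_nonneg_of_nonpos (by positivity) (hWle t ht)) (by positivity)) ?_
    linarith [wronskian_fst_snd_neg h ht]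
  have hanti : AntitoneOn F (Ioo 0 1) := by
    refine antitoneOn_of_hasDerivWithinAt_nonpos (f' := F') (convex_Ioo 0 1)
      (fun t ht => (hd t ht).continuousAt.continuousWithinAt)
      (fun t ht => (hd t (interior_subset ht)).hasDerivWithinAt)
      (fun t ht => ?_)
    have ht' := interior_subset ht
    exact add_nonpos (hterm₁ t ht') (hterm₂ t ht')
  obtain ⟨lu, ldu⟩ := h.sol_fst.tendsto_left one_pos
  obtain ⟨lp, ldp⟩ := k.sol_fst.tendsto_left one_pos
  -- At the center `S` vanishes because `u` and `p` have zero derivative, and `W` vanishes to higher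
  -- order than `v²`.
  have lim0 : Tendsto F (𝓝[>] 0) (𝓝 0) := by
    have h1 := k.sol_snd.tendsto_div_left h.sol_snd one_pos k.snd_zero h.snd_zero
      h.deriv_snd_zero.ne'
    have h2 := k.sol_snd.tendsto_wronskian_div_sq h.sol_snd one_pos hR hQ
      (fun t ht => (h.snd_pos t ht).ne') k.snd_zero h.snd_zero h.deriv_snd_zero.ne'
    have := (h1.mul ((ldp.mul lu).sub (lp.mul ldu))).sub ((lp.mul lu).mul h2)
    simpa [h.deriv_fst_zero, k.deriv_fst_zero] using this
  obtain ⟨ru, rdu⟩ := h.sol_fst.tendsto_right one_pos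
  obtain ⟨rp, rdp⟩ := k.sol_fst.tendsto_right one_pos
  obtain ⟨rv, rdv⟩ := h.sol_snd.tendsto_right one_pos
  obtain ⟨rw', rdw⟩ := k.sol_snd.tendsto_right one_pos
  -- Near `1` the second term is regrouped as `(p / v) (u / v) W`: all quotients have finite limits,
  -- while `S` and `W` tend to zero.
  have lim1 : Tendsto F (𝓝[<] 1) (𝓝 0) := by
    have h1 := k.sol_snd.tendsto_div_right h.sol_snd one_pos k.snd_one h.snd_one h.deriv_snd_one
    have h2 := k.sol_fst.tendsto_div_right h.sol_snd one_pos k.fst_one h.snd_one h.deriv_snd_one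
    have h3 := h.sol_fst.tendsto_div_right h.sol_snd one_pos h.fst_one h.snd_one h.deriv_snd_one
    have := (h1.mul ((rdp.mul ru).sub (rp.mul rdu))).sub
      ((h2.mul h3).mul ((rdw.mul rv).sub (rw'.mul rdv)))
    simp only [h.fst_one, k.fst_one, h.snd_one, k.snd_one, mul_zero, zero_mul, sub_zero] at this
    refine this.congr' ?_
    filter_upwards [Ioo_mem_nhdsLT one_pos] with t ht
    have hv := (h.snd_pos t ht).ne'
    simp only [hF, hW, hS]
    field_simp
  have hF0 : ∀ t ∈ Ioo (0 : ℝ) 1, F t = 0 := by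
    intro t ht
    refine le_antisymm ?_ ?_
    · refine ge_of_tendsto lim0 ?_
      filter_upwards [Ioo_mem_nhdsGT ht.1] with s hs
      exact hanti ⟨hs.1, hs.2.trans ht.2⟩ ht hs.2.le
    · refine le_of_tendsto lim1 ?_
      filter_upwards [Ioo_mem_nhdsLT ht.2] with s hs
      exact hanti ht ⟨ht.1.trans hs.1, hs.2⟩ hs.1.le
  have hF'0 : ∀ t ∈ Ioo (0 : ℝ) 1, F' t = 0 := by
    intro t ht
    refine (hd t ht).unique ((hasDerivAt_const t (0 : ℝ)).congr_of_eventuallyEq ?_)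
    filter_upwards [Ioo_mem_nhds ht.1 ht.2] with s hs using hF0 s hs
  have hboth : ∀ t ∈ Ioo (0 : ℝ) 1, w t / v t * (u t * p t) * ((ν₂ - ν₁) - (μ₂ - μ₁)) = 0 ∧
      2 * p t * W t / v t ^ 3 * (u t * dv t - du t * v t) = 0 := fun t ht => by
    have e : _ + _ = (0 : ℝ) := hF'0 t ht
    have e1 := hterm₁ t ht
    have e2 := hterm₂ t ht
    constructor <;> linarith
  constructor
  · have hmem : (1 / 2 : ℝ) ∈ Ioo (0 : ℝ) 1 := by norm_num
    obtain ⟨hu, hv, hp, hw⟩ := hpos _ hmem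
    have hne : w (1 / 2) / v (1 / 2) * (u (1 / 2) * p (1 / 2)) ≠ 0 := by positivity
    linarith [(mul_eq_zero.1 (hboth _ hmem).1).resolve_left hne]
  · intro t ht
    obtain ⟨hu, hv, hp, hw⟩ := hpos t ht
    have h1 := wronskian_fst_snd_neg h ht
    have h2 := (mul_eq_zero.1 (hboth t ht).2).resolve_right (by linarith)
    have h3 := (div_eq_zero_iff.1 h2).resolve_right (by positivity)
    exact (mul_eq_zero.1 h3).resolve_left (by positivity)

/-- Adding to an even potential a function that increases away from the center does not decrease
the spectral gap. -/
theorem gap_le_gap (h : IsGapData Q μ₁ μ₂ u du v dv) (k : IsGapData R ν₁ ν₂ p dp w dw)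
    (hQ : ContinuousOn Q (Icc 0 1)) (hR : ContinuousOn R (Icc 0 1))
    (hm : MonotoneOn (fun t => R t - Q t) (Icc 0 1)) : μ₂ - μ₁ ≤ ν₂ - ν₁ := by
  by_contra! hlt
  linarith [(gap_comparison_aux h k hQ hR hm hlt.le).1]

/-- Adding to an even potential a function that strictly increases away from the center strictly
increases the spectral gap. -/
theorem gap_lt_gap (h : IsGapData Q μ₁ μ₂ u du v dv) (k : IsGapData R ν₁ ν₂ p dp w dw)
    (hQ : ContinuousOn Q (Icc 0 1)) (hR : ContinuousOn R (Icc 0 1))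
    (hm : StrictMonoOn (fun t => R t - Q t) (Icc 0 1)) : μ₂ - μ₁ < ν₂ - ν₁ := by
  by_contra! hle
  have hW := (gap_comparison_aux h k hQ hR hm.monotoneOn hle).2
  -- `W` vanishes identically, hence so does `W' = (R - Q - ν₂ + μ₂) w v`, where `w v` is positive.
  have hconst : ∀ t ∈ Ioo (0 : ℝ) 1, R t - Q t = ν₂ - μ₂ := by
    intro t ht
    have h1 := k.sol_snd.hasDerivAt_wronskian h.sol_snd ht
    have h2 := h1.unique ((hasDerivAt_const t (0 : ℝ)).congr_of_eventuallyEq (by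
      filter_upwards [Ioo_mem_nhds ht.1 ht.2] with s hs using hW s hs))
    have h3 := mul_pos (k.snd_pos t ht) (h.snd_pos t ht)
    linarith [(mul_eq_zero.1 h2).resolve_right h3.ne']
  have h1 := hconst (1 / 3) (by norm_num)
  have h2 := hconst (2 / 3) (by norm_num)
  have h3 : R (1 / 3) - Q (1 / 3) < R (2 / 3) - Q (2 / 3) :=
    hm (by norm_num) (by norm_num) (by norm_num)
  linarith

/-- The first two eigenfunctions of the free operator. -/
lemma isGapData_zero : IsGapData (fun _ => 0) ((Real.pi / 2) ^ 2) (Real.pi ^ 2)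
    (fun t => Real.cos (Real.pi / 2 * t)) (fun t => -(Real.pi / 2 * Real.sin (Real.pi / 2 * t)))
    (fun t => Real.sin (Real.pi * t)) (fun t => Real.pi * Real.cos (Real.pi * t)) := by
  have hl : ∀ c t : ℝ, HasDerivWithinAt (fun t : ℝ => c * t) c (Icc 0 1) t := fun c t => by
    simpa using (hasDerivWithinAt_id t (Icc (0 : ℝ) 1)).const_mul c
  have hpi := Real.pi_pos
  refine ⟨fun t _ => ⟨?_, ?_⟩, fun t _ => ⟨?_, ?_⟩, ?_, fun t ht => ?_, ?_, ?_, fun t ht => ?_,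
    ?_, ?_, ?_, ?_⟩
  · exact (hl _ t).cos.congr_deriv (by ring)
  · exact ((hl _ t).sin.const_mul _).neg.congr_deriv (by ring)
  · exact (hl _ t).sin.congr_deriv (by ring)
  · exact ((hl _ t).cos.const_mul _).congr_deriv (by ring)
  · nlinarith
  · exact Real.cos_pos_of_mem_Ioo ⟨by nlinarith [ht.1], by nlinarith [ht.2]⟩
  · simp
  · simp
  · exact Real.sin_pos_of_pos_of_lt_pi (by nlinarith [ht.1]) (by nlinarith [ht.2])
  · simp
  · simp
  · simpa using hpi
  · simp [hpi.ne']

/-! ### Calculus of `sn`, `cs` and `tn` -/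

lemma hasDerivAt_sn (K s : ℝ) : HasDerivAt (sn K) (cs K s) s := by
  have hl : ∀ c : ℝ, HasDerivAt (fun t : ℝ => c * t) c s := fun c => by
    simpa using (hasDerivAt_id s).const_mul c
  unfold sn cs
  by_cases h1 : 0 < K
  · simp only [h1, if_true]
    have := (Real.sqrt_pos.2 h1).ne'
    exact ((hl _).sin.div_const _).congr_deriv (by field_simp)
  · by_cases h2 : K < 0
    · simp only [h1, h2, if_true, if_false]
      have := (Real.sqrt_pos.2 (neg_pos.2 h2)).ne'
      exact ((hl _).sinh.div_const _).congr_deriv (by field_simp)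
    · simp only [h1, h2, if_false]
      exact hasDerivAt_id s

lemma hasDerivAt_cs (K s : ℝ) : HasDerivAt (cs K) (-(K * sn K s)) s := by
  have hl : ∀ c : ℝ, HasDerivAt (fun t : ℝ => c * t) c s := fun c => by
    simpa using (hasDerivAt_id s).const_mul c
  unfold sn cs
  by_cases h1 : 0 < K
  · simp only [h1, if_true]
    have h0 := (Real.sqrt_pos.2 h1).ne'
    have hs := Real.sq_sqrt h1.le
    refine (hl _).cos.congr_deriv ?_
    field_simp
    rw [hs, mul_comm]
  · by_cases h2 : K < 0
    · simp only [h1, h2, if_true, if_false]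
      have h0 := (Real.sqrt_pos.2 (neg_pos.2 h2)).ne'
      have hs := Real.sq_sqrt (neg_pos.2 h2).le
      refine (hl _).cosh.congr_deriv ?_
      field_simp
      rw [hs, neg_mul]
    · simp only [h1, h2, if_false]
      have : K = 0 := le_antisymm (not_lt.1 h1) (not_lt.1 h2)
      simpa [this] using hasDerivAt_const s (1 : ℝ)

lemma cs_sq_add (K s : ℝ) : cs K s ^ 2 + K * sn K s ^ 2 = 1 := by
  unfold sn cs
  by_cases h1 : 0 < K
  · simp only [h1, if_true]
    have h0 := (Real.sqrt_pos.2 h1).ne'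
    rw [div_pow, Real.sq_sqrt h1.le, mul_div_cancel₀ _ h1.ne']
    exact Real.cos_sq_add_sin_sq _
  · by_cases h2 : K < 0
    · simp only [h1, h2, if_true, if_false]
      rw [div_pow, Real.sq_sqrt (neg_pos.2 h2).le, div_neg, mul_neg, mul_div_cancel₀ _ h2.ne]
      linarith [Real.cosh_sq (√(-K) * s)]
    · simp only [h1, h2, if_false]
      have : K = 0 := le_antisymm (not_lt.1 h1) (not_lt.1 h2)
      simp [this]

lemma cs_neg (K s : ℝ) : cs K (-s) = cs K s := by
  simp [cs]

lemma hasDerivAt_tn {K s : ℝ} (h : cs K s ≠ 0) : HasDerivAt (tn K) (K / cs K s ^ 2) s := by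
  refine (((hasDerivAt_sn K s).const_mul K).div (hasDerivAt_cs K s) h).congr_deriv ?_
  congr 1
  linear_combination K * cs_sq_add K s

lemma tn_sq {K s : ℝ} (h : cs K s ≠ 0) : tn K s ^ 2 = K / cs K s ^ 2 - K := by
  rw [tn]
  field_simp
  linear_combination K * cs_sq_add K s

/-! ### The Liouville transform -/

/-- The potential of the Schrödinger form of the model, rescaled to `[-1, 1]`. -/
noncomputable def potential (n : ℕ) (K D x : ℝ) : ℝ :=
  ((n : ℝ) - 1) * ((n : ℝ) - 3) / 4 * ((D / 2) ^ 2 * (K / cs K (D / 2 * x) ^ 2))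

/-- The spectral parameter of the rescaled Schrödinger form. -/
noncomputable def spectralShift (n : ℕ) (K D lam : ℝ) : ℝ :=
  (D / 2) ^ 2 * (lam + (((n : ℝ) - 1) / 2) ^ 2 * K)

/-- The Liouville transform. -/
lemma mem_eigenvalues_iff {n : ℕ} {K D lam : ℝ} (hD : 0 < D)
    (hcs : ∀ s ∈ Icc (-(D / 2)) (D / 2), 0 < cs K s) :
    lam ∈ eigenvalues n D K ↔
      spectralShift n K D lam ∈ schrodingerEigenvalues (potential n K D) := by
  obtain ⟨l, rfl⟩ : ∃ l, D = 2 * l := ⟨D / 2, by ring⟩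
  obtain ⟨k, hk⟩ : ∃ k : ℝ, (n : ℝ) = 2 * k + 1 := ⟨((n : ℝ) - 1) / 2, by ring⟩
  have e : 2 * l / 2 = l := by ring
  have hl : 0 < l := by linarith
  rw [e] at hcs
  -- With `k = (n - 1) / 2` the logarithmic derivative of `w` is `-k tn_K`, exactly what cancels the
  -- first-order term; `k` may be a half-integer, hence the real power. The potential's coefficient
  -- is `k (k - 1)`.
  set w : ℝ → ℝ := fun s => cs K s ^ k with hwdef
  have hw0 : ∀ s ∈ Icc (-l) l, w s ≠ 0 := fun s hs => (Real.rpow_pos_of_pos (hcs s hs) _).ne'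
  have hw : ∀ s ∈ Icc (-l) l, HasDerivAt w (-(k * tn K s * w s)) s := by
    intro s hs
    have hc := hcs s hs
    refine ((hasDerivAt_cs K s).rpow_const (p := k) (Or.inl hc.ne')).congr_deriv ?_
    rw [hwdef, tn, Real.rpow_sub_one hc.ne']
    field_simp
  have htn : ∀ s ∈ Icc (-l) l, HasDerivAt (tn K) (tn K s ^ 2 + K) s := fun s hs =>
    (hasDerivAt_tn (hcs s hs).ne').congr_deriv (by rw [tn_sq (hcs s hs).ne']; ring)
  have hpot : ∀ x ∈ Icc (-1 : ℝ) 1, potential n K (2 * l) x - spectralShift n K (2 * l) lam =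
      l ^ 2 * (k * (k - 1) * (tn K (l * x) ^ 2 + K) - k ^ 2 * K - lam) := by
    intro x hx
    have hm : l * x ∈ Icc (-l) l := ⟨by nlinarith [hx.1], by nlinarith [hx.2]⟩
    rw [potential, spectralShift, e, tn_sq (hcs _ hm).ne', hk]
    ring
  constructor
  · rintro ⟨φ, dφ, ddφ, hφ, h1, h2, s, hs, hne⟩
    rw [e] at hφ h1 h2 hs
    have hmaps : MapsTo (fun x : ℝ => l * x) (Icc (-1) 1) (Icc (-l) l) :=
      fun x hx => ⟨by nlinarith [hx.1], by nlinarith [hx.2]⟩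
    refine ⟨fun x => w (l * x) * φ (l * x),
      fun x => l * (w (l * x) * (dφ (l * x) - k * tn K (l * x) * φ (l * x))),
      fun x hx => ?_, by simp [h1], by simp [h2], s / l, ?_, ?_⟩
    · have hx' := hmaps hx
      obtain ⟨d1, d2, heq⟩ := hφ _ hx'
      have hlin : HasDerivWithinAt (fun x : ℝ => l * x) l (Icc (-1) 1) x := by
        simpa using (hasDerivWithinAt_id x (Icc (-1 : ℝ) 1)).const_mul l
      have c1 := d1.comp x hlin hmaps
      have c2 := d2.comp x hlin hmaps
      have cw := (hw _ hx').comp_hasDerivWithinAt x hlin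
      have ct := (htn _ hx').comp_hasDerivWithinAt x hlin
      constructor
      · exact (cw.mul c1).congr_deriv (by simp only [Function.comp_apply]; ring)
      · refine ((cw.mul (c2.sub ((ct.const_mul k).mul c1))).const_mul l).congr_deriv ?_
        rw [hpot x hx]
        simp only [Function.comp_apply, Pi.sub_apply, Pi.mul_apply]
        rw [hk] at heq
        linear_combination l ^ 2 * w (l * x) * heq
    · rw [mem_Icc, le_div_iff₀ hl, div_le_iff₀ hl]
      exact ⟨by linarith [hs.1], by linarith [hs.2]⟩
    · have : l * (s / l) = s := by field_simp
      simp only [this]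
      exact mul_ne_zero (hw0 s hs) hne
  · rintro ⟨u, du, hu, h1, h2, x, hx, hne⟩
    have hmaps : MapsTo (fun s : ℝ => s / l) (Icc (-l) l) (Icc (-1) 1) := fun s hs => by
      rw [mem_Icc, le_div_iff₀ hl, div_le_iff₀ hl]
      exact ⟨by linarith [hs.1], by linarith [hs.2]⟩
    set dφ : ℝ → ℝ := fun s => (w s)⁻¹ * (du (s / l) / l + k * tn K s * u (s / l)) with hdφ
    refine ⟨fun s => (w s)⁻¹ * u (s / l), dφ,
      fun s => 2 * k * tn K s * dφ s - lam * ((w s)⁻¹ * u (s / l)), ?_, ?_, ?_, l * x, ?_, ?_⟩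
    · rw [e]
      intro s hs
      have hx' := hmaps hs
      have hw0s := hw0 s hs
      obtain ⟨d1, d2⟩ := hu _ hx'
      have hlin : HasDerivWithinAt (fun s : ℝ => s / l) (1 / l) (Icc (-l) l) s :=
        (hasDerivWithinAt_id s _).div_const l
      have c1 := d1.comp s hlin hmaps
      have c2 := d2.comp s hlin hmaps
      have cw := (hw s hs).hasDerivWithinAt.inv (s := Icc (-l) l) hw0s
      have ct := (htn s hs).hasDerivWithinAt (s := Icc (-l) l)
      refine ⟨?_, ?_, ?_⟩
      · refine (cw.mul c1).congr_deriv ?_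
        simp only [Function.comp_apply, hdφ, Pi.inv_apply]
        field_simp
        ring
      · refine (cw.mul ((c2.div_const l).add ((ct.const_mul k).mul c1))).congr_deriv ?_
        rw [hpot _ hx']
        have hsl : l * (s / l) = s := by field_simp
        simp only [Function.comp_apply, hdφ, Pi.inv_apply, hsl, Pi.add_apply, Pi.mul_apply]
        field_simp
        ring
      · rw [hk]; ring
    · simp [e, neg_div, div_self hl.ne', h1]
    · simp [e, div_self hl.ne', h2]
    · rw [e]; exact ⟨by nlinarith [hx.1], by nlinarith [hx.2]⟩
    · have hlx : l * x / l = x := by field_simp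
      simp only [hlx]
      exact mul_ne_zero (inv_ne_zero (hw0 _ ⟨by nlinarith [hx.1], by nlinarith [hx.2]⟩)) hne

lemma continuousOn_potential {n : ℕ} {K D : ℝ} (hD : 0 < D)
    (hcs : ∀ s ∈ Icc (-(D / 2)) (D / 2), 0 < cs K s) :
    ContinuousOn (potential n K D) (Icc (-1) 1) := by
  have hc : Continuous (cs K) := continuous_iff_continuousAt.2 fun s =>
    (hasDerivAt_cs K s).continuousAt
  have hc' : Continuous fun x => cs K (D / 2 * x) ^ 2 := by fun_prop
  refine continuousOn_const.mul (continuousOn_const.mul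
    (continuousOn_const.div hc'.continuousOn fun x hx => pow_ne_zero 2 (hcs _ ?_).ne'))
  exact ⟨by nlinarith [hx.1], by nlinarith [hx.2]⟩

/-- The eigenvalues of the model and their Schrödinger form. -/
theorem exists_isGapData_potential {n : ℕ} {K D : ℝ} (hD : 0 < D)
    (hcs : ∀ s ∈ Icc (-(D / 2)) (D / 2), 0 < cs K s) :
    IsLeast (eigenvalues n D K) (lambda1 n D K) ∧
      IsLeast (eigenvalues n D K ∩ Ioi (lambda1 n D K)) (lambda2 n D K) ∧
      ∃ μ ν u du v dv, IsGapData (potential n K D) μ ν u du v dv ∧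
        D ^ 2 * gap n D K = 4 * (ν - μ) := by
  obtain ⟨μ, ν, u, du, v, dv, hdata, hμ, hν⟩ :=
    exists_isGapData (continuousOn_potential (n := n) hD hcs)
      (fun t _ => by simp only [potential, mul_neg, cs_neg])
  have hmono : StrictMono (spectralShift n K D) := fun a b hab => by
    have : 0 < (D / 2) ^ 2 := by positivity
    exact mul_lt_mul_of_pos_left (by linarith) this
  have hsurj : ∀ μ, ∃ lam, spectralShift n K D lam = μ := fun μ =>
    ⟨μ / (D / 2) ^ 2 - (((n : ℝ) - 1) / 2) ^ 2 * K, by rw [spectralShift]; field_simp; ring⟩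
  obtain ⟨a, rfl⟩ := hsurj μ
  obtain ⟨b, rfl⟩ := hsurj ν
  have ha : IsLeast (eigenvalues n D K) a :=
    ⟨(mem_eigenvalues_iff hD hcs).2 hμ.1,
      fun l hl => hmono.le_iff_le.1 (hμ.2 ((mem_eigenvalues_iff hD hcs).1 hl))⟩
  have h1 : lambda1 n D K = a := ha.csInf_eq
  have hb : IsLeast (eigenvalues n D K ∩ Ioi a) b :=
    ⟨⟨(mem_eigenvalues_iff hD hcs).2 hν.1.1, hmono.lt_iff_lt.1 hν.1.2⟩,
      fun l hl => hmono.le_iff_le.1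
        (hν.2 ⟨(mem_eigenvalues_iff hD hcs).1 hl.1, hmono hl.2⟩)⟩
  have h2 : lambda2 n D K = b := by rw [lambda2, h1]; exact hb.csInf_eq
  refine ⟨h1 ▸ ha, ?_, _, _, u, du, v, dv, hdata, ?_⟩
  · rw [h1, h2]; exact hb
  · rw [gap, h1, h2, spectralShift, spectralShift]; ring

/-! ### Monotonicity of the rescaled potential -/

lemma sn_zero (K : ℝ) : sn K 0 = 0 := by simp [sn]

lemma cs_pos {K D s : ℝ} (hK : 0 < K → D < Real.pi / √K) (hs : s ∈ Icc (-(D / 2)) (D / 2)) :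
    0 < cs K s := by
  unfold cs
  split_ifs with h1 h2
  · have h0 := Real.sqrt_pos.2 h1
    have h3 := (lt_div_iff₀ h0).1 (hK h1)
    refine Real.cos_pos_of_mem_Ioo ⟨?_, ?_⟩
    · nlinarith [hs.1]
    · nlinarith [hs.2]
  · exact Real.cosh_pos _
  · exact one_pos

lemma sn_pos {K D s : ℝ} (hK : 0 < K → D < Real.pi / √K) (hs : s ∈ Ioc 0 (D / 2)) :
    0 < sn K s := by
  unfold sn
  split_ifs with h1 h2
  · have h0 := Real.sqrt_pos.2 h1
    have h3 := (lt_div_iff₀ h0).1 (hK h1)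
    refine div_pos (Real.sin_pos_of_pos_of_lt_pi (mul_pos h0 hs.1) ?_) h0
    nlinarith [hs.1, hs.2]
  · have h0 := Real.sqrt_pos.2 (neg_pos.2 h2)
    exact div_pos (Real.sinh_pos_iff.2 (mul_pos h0 hs.1)) h0
  · exact hs.1

/-- The factor of `m_K'` that determines its sign. -/
noncomputable def signFactor (K s : ℝ) : ℝ :=
  3 * sn K s * cs K s + s * (1 + 2 * K * sn K s ^ 2)

lemma hasDerivAt_m {K s : ℝ} (h : cs K s ≠ 0) :
    HasDerivAt (m K) (K ^ 2 / cs K s ^ 4 * signFactor K s) s := by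
  have h1 := (((((hasDerivAt_cs K s).pow 2).inv (pow_ne_zero 2 h)).const_mul K).mul
    (((hasDerivAt_id s).mul (hasDerivAt_tn h)).const_add 1))
  refine h1.congr_deriv ?_
  simp only [Pi.inv_apply, Pi.pow_apply, Pi.mul_apply, id, tn, signFactor]
  field_simp
  push_cast
  ring

lemma hasDerivAt_inv_cs_sq {K s : ℝ} (h : cs K s ≠ 0) :
    HasDerivAt (fun s => K / cs K s ^ 2) (2 * K ^ 2 * sn K s / cs K s ^ 3) s := by
  refine ((hasDerivAt_const s K).div ((hasDerivAt_cs K s).pow 2) (pow_ne_zero 2 h)).congr_deriv ?_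
  simp only [Pi.pow_apply]
  field_simp
  push_cast
  ring

/-- With `f = K / cs_K²`, both `(s³ f')' = s² (3 f' + s f'')` and `2 m_K' = 3 f' + s f''`, so the
same factor governs both signs. -/
lemma hasDerivAt_cube_mul {K s : ℝ} (h : cs K s ≠ 0) :
    HasDerivAt (fun s => s ^ 3 * (2 * K ^ 2 * sn K s / cs K s ^ 3))
      (2 * K ^ 2 * s ^ 2 / cs K s ^ 4 * signFactor K s) s := by
  refine ((hasDerivAt_pow 3 s).mul ((((hasDerivAt_sn K s).const_mul (2 * K ^ 2))).div
    ((hasDerivAt_cs K s).pow 3) (pow_ne_zero 3 h))).congr_deriv ?_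
  simp only [Pi.pow_apply, Pi.div_apply, signFactor]
  field_simp
  push_cast
  linear_combination K ^ 2 * s ^ 3 * cs K s ^ 2 * cs_sq_add K s

lemma strictMonoOn_cube_mul {K l : ℝ} (hK : K ≠ 0) (hcs : ∀ s ∈ Icc 0 l, 0 < cs K s)
    (hsign : ∀ s ∈ Ioo 0 l, 0 < signFactor K s) :
    StrictMonoOn (fun s => s ^ 3 * (2 * K ^ 2 * sn K s / cs K s ^ 3)) (Icc 0 l) := by
  refine strictMonoOn_of_deriv_pos (convex_Icc 0 l)
    (fun s hs => (hasDerivAt_cube_mul (hcs s hs).ne').continuousAt.continuousWithinAt)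
    fun s hs => ?_
  rw [interior_Icc] at hs
  have hc := hcs s (Ioo_subset_Icc_self hs)
  rw [(hasDerivAt_cube_mul hc.ne').deriv]
  have := hsign s hs
  have := hs.1
  positivity

/-- The profile of the rescaled potential is increasing, faster for longer intervals. -/
lemma strictMonoOn_profile_sub {K l₁ l₂ : ℝ} (hK : K ≠ 0) (h1 : 0 < l₁) (h12 : l₁ < l₂)
    (hcs : ∀ s ∈ Icc 0 l₂, 0 < cs K s) (hsign : ∀ s ∈ Ioo 0 l₂, 0 < signFactor K s) :
    StrictMonoOn (fun x => l₂ ^ 2 * (K / cs K (l₂ * x) ^ 2) - l₁ ^ 2 * (K / cs K (l₁ * x) ^ 2))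
      (Icc 0 1) := by
  have hd : ∀ l, 0 < l → l ≤ l₂ → ∀ x ∈ Icc (0 : ℝ) 1,
      HasDerivAt (fun x => l ^ 2 * (K / cs K (l * x) ^ 2))
        (l ^ 2 * (2 * K ^ 2 * sn K (l * x) / cs K (l * x) ^ 3 * l)) x := by
    intro l hl hll x hx
    have hm : l * x ∈ Icc 0 l₂ := ⟨mul_nonneg hl.le hx.1, by nlinarith [hx.2]⟩
    have hlin : HasDerivAt (fun x : ℝ => l * x) l x := by
      simpa using (hasDerivAt_id x).const_mul l
    exact ((hasDerivAt_inv_cs_sq (hcs _ hm).ne').comp x hlin).const_mul _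
  have hD : ∀ x ∈ Icc (0 : ℝ) 1, HasDerivAt _ _ x := fun x hx =>
    (hd l₂ (h1.trans h12) le_rfl x hx).sub (hd l₁ h1 h12.le x hx)
  refine strictMonoOn_of_deriv_pos (convex_Icc 0 1)
    (fun x hx => (hD x hx).continuousAt.continuousWithinAt) fun x hx => ?_
  rw [interior_Icc] at hx
  have e := (hD x (Ioo_subset_Icc_self hx)).deriv
  -- Multiplied by `x³`, the derivative of `l² f(l x)` becomes `s³ f'(s)` at `s = l x`, so comparing
  -- two lengths means comparing one increasing function at `l₁ x` and `l₂ x`.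
  have hg := strictMonoOn_cube_mul hK hcs hsign
    (show l₁ * x ∈ Icc 0 l₂ from ⟨mul_nonneg h1.le hx.1.le, by nlinarith [hx.1, hx.2]⟩)
    (show l₂ * x ∈ Icc 0 l₂ from ⟨by nlinarith [hx.1], by nlinarith [hx.2]⟩)
    (mul_lt_mul_of_pos_right h12 hx.1)
  have hx3 : 0 < x ^ 3 := pow_pos hx.1 3
  refine lt_of_lt_of_eq (a := 0) ?_ e.symm
  refine (mul_pos_iff_of_pos_left hx3).1 ?_
  simp only at hg
  linear_combination hg

lemma monotoneOn_profile {K l : ℝ} (hl : 0 < l) (hcs : ∀ s ∈ Icc 0 l, 0 < cs K s)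
    (hsn : ∀ s ∈ Icc 0 l, 0 ≤ sn K s) :
    MonotoneOn (fun x => l ^ 2 * (K / cs K (l * x) ^ 2)) (Icc 0 1) := by
  have hm : ∀ x ∈ Icc (0 : ℝ) 1, l * x ∈ Icc 0 l := fun x hx =>
    ⟨mul_nonneg hl.le hx.1, by nlinarith [hx.2]⟩
  refine monotoneOn_of_deriv_Icc
    (f' := fun x => l ^ 2 * (2 * K ^ 2 * sn K (l * x) / cs K (l * x) ^ 3 * l)) (fun x hx => ?_)
    (fun x hx => ?_)
  · have hlin : HasDerivAt (fun x : ℝ => l * x) l x := by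
      simpa using (hasDerivAt_id x).const_mul l
    exact (((hasDerivAt_inv_cs_sq (hcs _ (hm x hx)).ne').comp x hlin).const_mul _).hasDerivWithinAt
  · have h1 := hcs _ (hm x hx)
    have h2 := hsn _ (hm x hx)
    positivity

/-! ### Monotonicity in the length and the lower bound -/

section Gap

variable {n : ℕ} {K D D₁ D₂ : ℝ}

/-- The longer interval has the faster increasing profile. Its coefficient `(n-1)(n-3)/4` is
positive for `n > 3` and equals `-1/4` for `n = 2`, where the two lengths exchange roles in the
comparison. -/
lemma gap_scaled_lt (hK0 : K ≠ 0) (h1 : 0 < D₁) (h12 : D₁ < D₂) (hK : 0 < K → D₂ < Real.pi / √K)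
    (hsign : ∀ s ∈ Ioo 0 (D₂ / 2), 0 < signFactor K s) :
    (3 < n → D₁ ^ 2 * gap n D₁ K < D₂ ^ 2 * gap n D₂ K) ∧
      D₂ ^ 2 * gap 2 D₂ K < D₁ ^ 2 * gap 2 D₁ K := by
  have h2 : 0 < D₂ := h1.trans h12
  have hcs₂ : ∀ s ∈ Icc (-(D₂ / 2)) (D₂ / 2), 0 < cs K s := fun s hs => cs_pos hK hs
  have hcs₁ : ∀ s ∈ Icc (-(D₁ / 2)) (D₁ / 2), 0 < cs K s := fun s hs =>
    hcs₂ s ⟨by linarith [hs.1], by linarith [hs.2]⟩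
  have hsub : Icc (0 : ℝ) 1 ⊆ Icc (-1) 1 := Icc_subset_Icc (by norm_num) le_rfl
  have hm := strictMonoOn_profile_sub hK0 (half_pos h1) (show D₁ / 2 < D₂ / 2 by linarith)
    (fun s hs => hcs₂ s ⟨by linarith [hs.1], hs.2⟩) hsign
  constructor
  · intro hn
    obtain ⟨-, -, μ, ν, u, du, v, dv, h, e1⟩ := exists_isGapData_potential (n := n) h1 hcs₁
    obtain ⟨-, -, μ', ν', u', du', v', dv', h', e2⟩ := exists_isGapData_potential (n := n) h2 hcs₂
    have hn' : (3 : ℝ) < n := by exact_mod_cast hn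
    have hc : 0 < ((n : ℝ) - 1) * ((n : ℝ) - 3) / 4 :=
      div_pos (mul_pos (by linarith) (by linarith)) (by norm_num)
    have := gap_lt_gap h h' ((continuousOn_potential h1 hcs₁).mono hsub)
      ((continuousOn_potential h2 hcs₂).mono hsub) (fun x hx y hy hxy => by
        have := mul_lt_mul_of_pos_left (hm hx hy hxy) hc
        simp only [potential]
        linarith)
    rw [e1, e2]
    linarith
  · obtain ⟨-, -, μ, ν, u, du, v, dv, h, e1⟩ := exists_isGapData_potential (n := 2) h1 hcs₁
    obtain ⟨-, -, μ', ν', u', du', v', dv', h', e2⟩ := exists_isGapData_potential (n := 2) h2 hcs₂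
    have := gap_lt_gap h' h ((continuousOn_potential h2 hcs₂).mono hsub)
      ((continuousOn_potential h1 hcs₁).mono hsub) (fun x hx y hy hxy => by
        have := hm hx hy hxy
        simp only [potential]
        norm_num at this ⊢
        linarith)
    rw [e1, e2]
    linarith

/-- For `n ≥ 3` the potential is nondecreasing on `[0, 1]`, so its gap is at least the free gap `π²
- (π/2)² = 3π²/4`. -/
lemma three_mul_pi_sq_le_gap (hn : 3 ≤ n) (hD : 0 < D) (hK : 0 < K → D < Real.pi / √K) :
    3 * Real.pi ^ 2 / D ^ 2 ≤ gap n D K := by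
  have hcs : ∀ s ∈ Icc (-(D / 2)) (D / 2), 0 < cs K s := fun s hs => cs_pos hK hs
  have hsub : Icc (0 : ℝ) 1 ⊆ Icc (-1) 1 := Icc_subset_Icc (by norm_num) le_rfl
  have hm := monotoneOn_profile (K := K) (half_pos hD)
    (fun s hs => hcs s ⟨by linarith [hs.1], hs.2⟩) (fun s hs => by
      rcases hs.1.eq_or_lt with h0 | h0
      · rw [← h0, sn_zero]
      · exact (sn_pos hK ⟨h0, hs.2⟩).le)
  obtain ⟨-, -, μ, ν, u, du, v, dv, h, e⟩ := exists_isGapData_potential (n := n) hD hcs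
  have hn' : (3 : ℝ) ≤ n := by exact_mod_cast hn
  have hc : 0 ≤ ((n : ℝ) - 1) * ((n : ℝ) - 3) / 4 :=
    div_nonneg (mul_nonneg (by linarith) (by linarith)) (by norm_num)
  have := gap_le_gap isGapData_zero h continuousOn_const
    ((continuousOn_potential hD hcs).mono hsub) (fun x hx y hy hxy => by
      have := mul_le_mul_of_nonneg_left (hm hx hy hxy) hc
      simp only [potential, sub_zero]
      linarith)
  rw [div_le_iff₀ (by positivity)]
  nlinarith

end Gap

/-! ### The sign of `m_K'` -/

lemma signFactor_pos {K D s : ℝ} (hK : 0 < K) (hD : D < Real.pi / √K) (hs : s ∈ Ioc 0 (D / 2)) :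
    0 < signFactor K s := by
  have h1 := sn_pos (fun _ => hD) hs
  have h2 := cs_pos (K := K) (D := D) (s := s) (fun _ => hD) ⟨by linarith [hs.1, hs.2], hs.2⟩
  have := hs.1
  unfold signFactor
  positivity

/-- The second derivative `sinh w - w cosh w` vanishes at zero and has derivative `-w sinh w`, hence
is negative for `w > 0`. -/
lemma strictConcaveOn_sinh_aux :
    StrictConcaveOn ℝ (Ici 0) fun w => 3 * Real.sinh w + 2 * w - w * Real.cosh w := by
  have h1 : ∀ w, HasDerivAt (fun w => 3 * Real.sinh w + 2 * w - w * Real.cosh w)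
      (2 * Real.cosh w + 2 - w * Real.sinh w) w := fun w =>
    ((((Real.hasDerivAt_sinh w).const_mul 3).add ((hasDerivAt_id w).const_mul 2)).sub
      ((hasDerivAt_id w).mul (Real.hasDerivAt_cosh w))).congr_deriv (by simp only [id]; ring)
  have h2 : ∀ w, HasDerivAt (fun w => 2 * Real.cosh w + 2 - w * Real.sinh w)
      (Real.sinh w - w * Real.cosh w) w := fun w =>
    ((((Real.hasDerivAt_cosh w).const_mul 2).add_const 2).sub
      ((hasDerivAt_id w).mul (Real.hasDerivAt_sinh w))).congr_deriv (by simp only [id]; ring)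
  have h3 : ∀ w, HasDerivAt (fun w => Real.sinh w - w * Real.cosh w) (-(w * Real.sinh w)) w :=
    fun w => ((Real.hasDerivAt_sinh w).sub
      ((hasDerivAt_id w).mul (Real.hasDerivAt_cosh w))).congr_deriv (by simp only [id]; ring)
  have h4 : StrictAntiOn (fun w => Real.sinh w - w * Real.cosh w) (Ici 0) := by
    refine strictAntiOn_of_deriv_neg (convex_Ici 0)
      (fun w _ => (h3 w).continuousAt.continuousWithinAt) fun w hw => ?_
    rw [interior_Ici] at hw
    rw [(h3 w).deriv]
    exact neg_lt_zero.2 (mul_pos hw (Real.sinh_pos_iff.2 hw))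
  have h5 : StrictAntiOn (fun w => 2 * Real.cosh w + 2 - w * Real.sinh w) (Ici 0) := by
    refine strictAntiOn_of_deriv_neg (convex_Ici 0)
      (fun w _ => (h2 w).continuousAt.continuousWithinAt) fun w hw => ?_
    rw [interior_Ici] at hw
    rw [(h2 w).deriv]
    simpa using h4 self_mem_Ici (Ioi_subset_Ici_self hw) hw
  refine StrictAntiOn.strictConcaveOn_of_deriv (convex_Ici 0)
    (fun w _ => (h1 w).continuousAt.continuousWithinAt) ?_
  have e : deriv (fun w => 3 * Real.sinh w + 2 * w - w * Real.cosh w) =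
      fun w => 2 * Real.cosh w + 2 - w * Real.sinh w := funext fun w => (h1 w).deriv
  rw [e]
  exact h5.mono interior_subset

/-- A strictly concave function vanishing at `0` that is positive at `1` and negative at `4` has
exactly one positive zero. -/
lemma exists_zero_sinh_aux : ∃ w₀ : ℝ, 0 < w₀ ∧
    (∀ w, 0 < w → w < w₀ → 0 < 3 * Real.sinh w + 2 * w - w * Real.cosh w) ∧
    3 * Real.sinh w₀ + 2 * w₀ - w₀ * Real.cosh w₀ = 0 ∧
    ∀ w, w₀ < w → 3 * Real.sinh w + 2 * w - w * Real.cosh w < 0 := by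
  set N : ℝ → ℝ := fun w => 3 * Real.sinh w + 2 * w - w * Real.cosh w with hN
  have hconc : StrictConcaveOn ℝ (Ici 0) N := strictConcaveOn_sinh_aux
  have N0 : N 0 = 0 := by simp [hN]
  have hcont : Continuous N := by
    have := Real.continuous_sinh
    have := Real.continuous_cosh
    fun_prop
  have N1 : 0 < N 1 := by
    have h1 : 0 < Real.sinh 1 := Real.sinh_pos_iff.2 one_pos
    have h2 := Real.cosh_sub_sinh 1
    have h3 : Real.exp (-1) < 1 := Real.exp_lt_one_iff.mpr (by norm_num)
    simp only [hN]
    linarith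
  -- In exponentials `N 4 = 8 - e⁴/2 - 7 e⁻⁴/2`, and `e > 2` gives `e⁴ > 16`.
  have N4 : N 4 < 0 := by
    have h2 := Real.cosh_sub_sinh 4
    have h3 := Real.cosh_add_sinh 4
    have h4 : 0 < Real.exp (-4) := Real.exp_pos _
    have h5 : (2 : ℝ) < Real.exp 1 := by linarith [Real.exp_one_gt_d9]
    have h6 : Real.exp 4 = Real.exp 1 ^ 4 := by rw [← Real.exp_nat_mul]; norm_num
    have h7 : (2 : ℝ) ^ 4 < Real.exp 1 ^ 4 := by gcongr
    simp only [hN]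
    linarith
  obtain ⟨w₀, hw₀, h0⟩ := intermediate_value_Icc' (show (1 : ℝ) ≤ 4 by norm_num)
    hcont.continuousOn ⟨N4.le, N1.le⟩
  have hpos : 0 < w₀ := by linarith [hw₀.1]
  -- Concavity on the chord from `0` to `b`, with `N 0 = 0`, gives `N a > (a / b) N b`.
  have key : ∀ a b : ℝ, 0 < a → a < b → 0 ≤ N b → 0 < N a := by
    intro a b ha hab hb
    have hb0 : 0 < b := ha.trans hab
    have := hconc.2 self_mem_Ici (mem_Ici.2 hb0.le) hb0.ne
      (sub_pos.2 ((div_lt_one hb0).2 hab)) (div_pos ha hb0) (sub_add_cancel 1 (a / b))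
    rw [N0, smul_zero, zero_add, zero_add, smul_eq_mul, smul_eq_mul,
      div_mul_cancel₀ _ hb0.ne'] at this
    exact (mul_nonneg (div_pos ha hb0).le hb).trans_lt this
  refine ⟨w₀, hpos, fun w hw hlt => key w w₀ hw hlt h0.ge, h0, fun w hw => ?_⟩
  by_contra! hge
  exact absurd h0 (key w₀ w hpos hw hge).ne'

/-- Double-angle formulas with `w = 2 √(-K) s`: here `sn cs` is a multiple of `sinh w`, and `1 + 2 K
sn² = 2 - cosh w`. The zero for every `K < 0` is thus a rescaling of a single number. -/
lemma signFactor_of_neg {K : ℝ} (hK : K < 0) (s : ℝ) :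
    signFactor K s = (3 * Real.sinh (2 * √(-K) * s) + 2 * (2 * √(-K) * s) -
      2 * √(-K) * s * Real.cosh (2 * √(-K) * s)) / (2 * √(-K)) := by
  have h0 := (Real.sqrt_pos.2 (neg_pos.2 hK)).ne'
  have hs := Real.sq_sqrt (neg_pos.2 hK).le
  have hc := Real.cosh_sq (√(-K) * s)
  have hK' : K = -√(-K) ^ 2 := by rw [hs, neg_neg]
  rw [signFactor, sn, cs, if_neg hK.le.not_gt, if_neg hK.le.not_gt, if_pos hK, if_pos hK,
    mul_assoc 2 (√(-K)) s, Real.sinh_two_mul, Real.cosh_two_mul, hc]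
  generalize √(-K) = κ at *
  subst hK'
  field_simp
  ring

lemma exists_signFactor_zero {K : ℝ} (hK : K < 0) : ∃ a : ℝ, 0 < a ∧
    (∀ s, 0 < s → (signFactor K s = 0 ↔ s = a)) ∧ ∀ s ∈ Ioo 0 a, 0 < signFactor K s := by
  obtain ⟨w₀, hw₀, hlt, h0, hgt⟩ := exists_zero_sinh_aux
  have hκ : 0 < 2 * √(-K) := mul_pos two_pos (Real.sqrt_pos.2 (neg_pos.2 hK))
  have hpos : ∀ s ∈ Ioo 0 (w₀ / (2 * √(-K))), 0 < signFactor K s := fun s hs => by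
    rw [signFactor_of_neg hK]
    refine div_pos (hlt _ (mul_pos hκ hs.1) ?_) hκ
    have := (lt_div_iff₀ hκ).1 hs.2
    linarith
  refine ⟨w₀ / (2 * √(-K)), div_pos hw₀ hκ, fun s hs => ⟨fun h => ?_, ?_⟩, hpos⟩
  · rcases lt_trichotomy s (w₀ / (2 * √(-K))) with hl | he | hg
    · exact absurd h (hpos s ⟨hs, hl⟩).ne'
    · exact he
    · have h1 := (div_lt_iff₀ hκ).1 hg
      have h2 := div_neg_of_neg_of_pos (hgt (2 * √(-K) * s) (by linarith)) hκ
      rw [← signFactor_of_neg hK] at h2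
      exact absurd h h2.ne
  · rintro rfl
    rw [signFactor_of_neg hK, mul_div_cancel₀ _ hκ.ne', h0, zero_div]

lemma deriv_m_eq_zero_iff {K s : ℝ} (hK : K < 0) : deriv (m K) s = 0 ↔ signFactor K s = 0 := by
  -- The length `2 |s|` is chosen so that `s` lies in the symmetric interval.
  have hc : 0 < cs K s := cs_pos (D := 2 * |s|) (fun h => absurd h hK.le.not_gt) (by
    rw [mul_div_cancel_left₀ _ (two_ne_zero)]
    exact abs_le.1 le_rfl)
  rw [(hasDerivAt_m hc.ne').deriv, mul_eq_zero, or_iff_right]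
  have := pow_pos hc 4
  have := sq_pos_of_neg hK
  positivity

end ModelGap

/-- The first conjunct says that the two eigenvalues are what their names say (attained minima,
not junk infima). In the last one, `a = a(K)` is the only zero of `m_K'` on `(0, ∞)`. -/
theorem theorem2p1 :
    (∀ (n : ℕ) (K D : ℝ), 2 ≤ n → 0 < D → (0 < K → D < Real.pi / √K) →
      IsLeast (ModelGap.eigenvalues n D K) (ModelGap.lambda1 n D K) ∧
      IsLeast (ModelGap.eigenvalues n D K ∩ Set.Ioi (ModelGap.lambda1 n D K))
        (ModelGap.lambda2 n D K)) ∧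
    (∀ K : ℝ, 0 < K →
      (∀ n : ℕ, 3 < n →
        StrictMonoOn (fun D : ℝ => D ^ 2 * ModelGap.gap n D K) (Set.Ioo 0 (Real.pi / √K))) ∧
      StrictAntiOn (fun D : ℝ => D ^ 2 * ModelGap.gap 2 D K) (Set.Ioo 0 (Real.pi / √K))) ∧
    (∀ n : ℕ, 3 ≤ n → ∀ D ∈ Set.Ioo 0 Real.pi,
      3 * Real.pi ^ 2 / D ^ 2 ≤ ModelGap.gap n D 1) ∧
    (∀ K : ℝ, K < 0 → ∃ a : ℝ, 0 < a ∧
      (∀ s : ℝ, 0 < s → (deriv (ModelGap.m K) s = 0 ↔ s = a)) ∧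
      (∀ n : ℕ, 3 < n →
        StrictMonoOn (fun D : ℝ => D ^ 2 * ModelGap.gap n D K) (Set.Ioc 0 a)) ∧
      StrictAntiOn (fun D : ℝ => D ^ 2 * ModelGap.gap 2 D K) (Set.Ioc 0 a) ∧
      (∀ n : ℕ, 3 ≤ n → ∀ D ∈ Set.Ioc 0 a,
        3 * Real.pi ^ 2 / D ^ 2 ≤ ModelGap.gap n D K)) := by
  refine ⟨fun n K D _ hD hK => ?_, fun K hK => ⟨fun n hn => ?_, ?_⟩, fun n hn D hD => ?_,
    fun K hK => ?_⟩
  · obtain ⟨h1, h2, -⟩ := ModelGap.exists_isGapData_potential (n := n) hD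
      fun s hs => ModelGap.cs_pos hK hs
    exact ⟨h1, h2⟩
  · intro D₁ h₁ D₂ h₂ h
    exact (ModelGap.gap_scaled_lt hK.ne' h₁.1 h (fun _ => h₂.2) fun s hs =>
      ModelGap.signFactor_pos hK h₂.2 (Set.Ioo_subset_Ioc_self hs)).1 hn
  · intro D₁ h₁ D₂ h₂ h
    exact (ModelGap.gap_scaled_lt (n := 2) hK.ne' h₁.1 h (fun _ => h₂.2) fun s hs =>
      ModelGap.signFactor_pos hK h₂.2 (Set.Ioo_subset_Ioc_self hs)).2
  · exact ModelGap.three_mul_pi_sq_le_gap hn hD.1 fun _ => by simpa using hD.2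
  · obtain ⟨a, ha, hiff, hpos⟩ := ModelGap.exists_signFactor_zero hK
    have hK' : ∀ D : ℝ, 0 < K → D < Real.pi / √K := fun D h => absurd h hK.le.not_gt
    -- The potential only sees arguments up to the half-length `D / 2`, which lies below `a`.
    have hsign : ∀ D ∈ Set.Ioc 0 a, ∀ s ∈ Set.Ioo 0 (D / 2), 0 < ModelGap.signFactor K s :=
      fun D hD s hs => hpos s ⟨hs.1, by linarith [hs.2, hD.1, hD.2]⟩
    refine ⟨a, ha, fun s hs => (ModelGap.deriv_m_eq_zero_iff hK).trans (hiff s hs),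
      fun n hn => ?_, ?_, fun n hn D hD => ModelGap.three_mul_pi_sq_le_gap hn hD.1 (hK' D)⟩
    · intro D₁ h₁ D₂ h₂ h
      exact (ModelGap.gap_scaled_lt hK.ne h₁.1 h (hK' D₂) (hsign D₂ h₂)).1 hn
    · intro D₁ h₁ D₂ h₂ h
      exact (ModelGap.gap_scaled_lt (n := 2) hK.ne h₁.1 h (hK' D₂) (hsign D₂ h₂)).2
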